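/- Let $X$ be an infinite compact metric space, let $\mathscr V$ be a complex line bundle over $X$ with a (continuous) Hermitian structure, and let $\alpha : X \to X$ be an aperiodic homeomorphism, i.e. $\alpha^n(x) \neq x$ for all $x \in X$ and all $n \in \mathbb Z \setminus \{0\}$. Let $\mathcal E = \Gamma(\mathscr V,\alpha)$ be the $\mathrm C^*$-correspondence over $C(X)$ consisting of the continuous sections of $\mathscr V$, with right multiplication $(\xi f)(x) = \xi(x) f(x)$, inner product $\langle \xi, \eta\rangle(x) = \langle \xi(x), \eta(x)\rangle$ (linear in $\eta$) and left action $f\xi = \xi\,(f\circ\alpha)$. Let $\mathcal O(\mathcal E)$ be its Cuntz--Pimsner algebra, i.e. the $\mathrm C^*$-algebra generated by the universal covariant representation $(\pi, t)$ of $\mathcal E$ in the sense of Katsura, and let $C(X)\rtimes_\alpha\mathbb Z$ be the crossed product, i.e. the universal $\mathrm C^*$-algebra generated by a unital copy of $C(X)$ and a unitary $u$ with $u f u^* = f\circ\alpha^{-1}$. For a $\mathrm C^*$-algebra $A$ let $T(A)$ be the set of its tracial states with the weak-$*$ topology, and let $M^1(X,\alpha)$ be the set of $\alpha$-invariant Borel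 probability measures on $X$ with the weak topology (tested against $C(X)$). Let $\Phi(a) = \int_{\mathbb T}\sigma_z(a)\,dz$ be the conditional expectation of the gauge action $\sigma$ of the circle on $\mathcal O(\mathcal E)$, given by $\sigma_z(\pi(f)) = \pi(f)$ and $\sigma_z(t(\xi)) = z\,t(\xi)$. Then there are affine homeomorphisms \[ T(\mathcal O(\mathcal E)) \;\cong\; T(C(X)\rtimes_\alpha\mathbb Z) \;\cong\; M^1(X,\alpha). \] More precisely, for each of the two algebras, sending a tracial state $\tau$ to the measure $\mu$ with $\tau(f) = \int_X f\,d\mu$ for all $f\in C(X)$ (where $f$ is identified with its canonical image in the algebra) is an affine homeomorphism onto $M^1(X,\alpha)$. Moreover $\Phi$ takes its values in the canonical image of $C(X)$, and every $\tau\in T(\mathcal O(\mathcal E))$ satisfies $\tau = \tau|_{C(X)}\circ\Phi$. -/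

import Mathlib

open MeasureTheory
open scoped ENNReal NNReal ComplexOrder Topology

universe u v w

noncomputable section

set_option linter.unusedSectionVars false
set_option linter.checkUnivs false

/-! ### Correspondences and covariant representations -/

section Correspondences

variable (A : Type u) [CommCStarAlgebra A] [PartialOrder A] [StarOrderedRing A]
  (E : Type v) [NormedAddCommGroup E] [NormedSpace ℂ E] [CompleteSpace E] [Module A E]
  [CStarModule A E]

/-- A C⋆-correspondence over a commutative C⋆-algebra `A` on the Hilbert `A`-module `E`. The right
action `ξ a` is written `a • ξ`, and the inner product `inner A ξ η` is linear in `η`. The additional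
datum is the structure map, a ⋆-homomorphism from `A` to the adjointable operators on `E`. -/
structure CStarCorrespondence where
  /-- the left action -/
  φ : A →ₙₐ[ℂ] (E →L[ℂ] E)
  inner_φ_left : ∀ (a : A) (ξ η : E), inner A (φ a ξ) η = inner A ξ (φ (star a) η)

variable {A E}

theorem CStarModule.norm_smul_le' (a : A) (ξ : E) : ‖a • ξ‖ ≤ ‖a‖ * ‖ξ‖ := by
  have h : ‖a • ξ‖ ^ 2 ≤ (‖a‖ * ‖ξ‖) ^ 2 := by
    rw [mul_pow, CStarModule.norm_sq_eq A (x := a • ξ), CStarModule.norm_sq_eq A (x := ξ),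
      CStarModule.inner_op_smul_left, CStarModule.inner_op_smul_right]
    calc ‖a * inner A ξ ξ * star a‖ ≤ ‖a‖ * ‖inner A ξ ξ‖ * ‖star a‖ :=
          (norm_mul_le _ _).trans (by gcongr; exact norm_mul_le _ _)
      _ = ‖a‖ ^ 2 * ‖inner A ξ ξ‖ := by rw [norm_star]; ring
  exact (pow_le_pow_iff_left₀ (norm_nonneg _) (by positivity) two_ne_zero).1 h

theorem CStarModule.complex_smul_smul (c : ℂ) (a : A) (ξ : E) : (c • a) • ξ = c • (a • ξ) := by
  rw [← sub_eq_zero, ← CStarModule.inner_self (A := A)]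
  simp [CStarModule.inner_sub_left, CStarModule.inner_sub_right]

variable (A) in
/-- The rank one operator `ζ ↦ ξ ⟨η, ζ⟩`. -/
def rankOneOp (ξ η : E) : E →L[ℂ] E :=
  LinearMap.mkContinuous
    { toFun := fun ζ => (inner A η ζ : A) • ξ
      map_add' := fun x y => by rw [CStarModule.inner_add_right, add_smul]
      map_smul' := fun c x => by
        rw [CStarModule.inner_smul_right_complex, CStarModule.complex_smul_smul]; rfl }
    (‖η‖ * ‖ξ‖) (fun ζ => by
      calc ‖(inner A η ζ : A) • ξ‖ ≤ ‖(inner A η ζ : A)‖ * ‖ξ‖ := CStarModule.norm_smul_le' _ _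
        _ ≤ (‖η‖ * ‖ζ‖) * ‖ξ‖ := by gcongr; exact CStarModule.norm_inner_le E
        _ = ‖η‖ * ‖ξ‖ * ‖ζ‖ := by ring)

theorem rankOneOp_apply (ξ η ζ : E) : rankOneOp A ξ η ζ = (inner A η ζ : A) • ξ := rfl

variable (A E) in
/-- The compact operators `𝒦(E)`: the closed linear span of the rank one operators. -/
def compactOps : Submodule ℂ (E →L[ℂ] E) :=
  (Submodule.span ℂ (Set.range fun p : E × E => rankOneOp A p.1 p.2)).topologicalClosure

theorem rankOneOp_mem (ξ η : E) : rankOneOp A ξ η ∈ compactOps A E :=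
  Submodule.le_topologicalClosure _ (Submodule.subset_span ⟨(ξ, η), rfl⟩)

namespace CStarCorrespondence

variable (C : CStarCorrespondence A E)

/-- The ideal `J_E = φ⁻¹(𝒦(E)) ∩ (ker φ)^⊥`. -/
def katsuraIdeal : Set A :=
  {a | C.φ a ∈ compactOps A E ∧ ∀ b, C.φ b = 0 → a * b = 0}

theorem φ_mem {a : A} (ha : a ∈ C.katsuraIdeal) : C.φ a ∈ compactOps A E := ha.1

/-- A covariant representation `(π, t)` of a correspondence on a C⋆-algebra `B`. In the field
`covariant`, `ψ` is the map `ψ_t` on `𝒦(E)`, which is determined by continuity, linearity and its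
values `ψ_t(θ_{ξ,η}) = t(ξ) t(η)^*`. The C⋆-algebra generated by a representation is generated by
images of `A` and `E`, so it has a copy in the universe `max u v` of the targets used here. -/
structure CovariantRep where
  /-- the target -/
  B : Type (max u v)
  [cstar : NonUnitalCStarAlgebra B]
  π : A →⋆ₙₐ[ℂ] B
  t : E →ₗ[ℂ] B
  map_inner : ∀ ξ η : E, π (inner A ξ η) = star (t ξ) * t η
  map_left : ∀ (a : A) (ξ : E), π a * t ξ = t (C.φ a ξ)
  covariant : ∃ ψ : compactOps A E →L[ℂ] B,
    (∀ ξ η : E, ψ ⟨rankOneOp A ξ η, rankOneOp_mem ξ η⟩ = t ξ * star (t η)) ∧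
    ∀ (a : A) (ha : a ∈ C.katsuraIdeal), π a = ψ ⟨C.φ a, C.φ_mem ha⟩

attribute [instance] CovariantRep.cstar

variable {C} in
theorem CovariantRep.norm_t_le (R : C.CovariantRep) (ξ : E) : ‖R.t ξ‖ ≤ ‖ξ‖ := by
  have h : ‖R.t ξ‖ ^ 2 ≤ ‖ξ‖ ^ 2 := by
    rw [CStarModule.norm_sq_eq A (x := ξ), pow_two, ← CStarRing.norm_star_mul_self,
      ← R.map_inner]
    exact NonUnitalStarAlgHom.norm_apply_le R.π _
  exact (pow_le_pow_iff_left₀ (norm_nonneg _) (norm_nonneg _) two_ne_zero).1 h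

variable {C} in
/-- The representation `(π, z t)` for `z` on the unit circle. -/
def CovariantRep.rotate (z : Circle) (R : C.CovariantRep) :
    C.CovariantRep where
  B := R.B
  π := R.π
  t := (z : ℂ) • R.t
  map_inner ξ η := by
    have hz : (starRingEnd ℂ) (z : ℂ) * z = 1 := by
      rw [← Complex.normSq_eq_conj_mul_self]; simp
    simp [R.map_inner, smul_mul_smul_comm, hz]
  map_left a ξ := by simp [← R.map_left, mul_smul_comm]
  covariant := by
    have hz : (z : ℂ) * (starRingEnd ℂ) (z : ℂ) = 1 := by
      rw [mul_comm, ← Complex.normSq_eq_conj_mul_self]; simp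
    obtain ⟨ψ, h1, h2⟩ := R.covariant
    refine ⟨ψ, fun ξ η => ?_, h2⟩
    rw [h1]
    simp [smul_mul_smul_comm, hz]

/-- The `ℓ^∞`-product of the targets of all covariant representations. -/
abbrev Ambient : Type (max u v + 1) := lp (fun R : C.CovariantRep => R.B) ∞

/-- The direct sum of the maps `π` over all covariant representations. -/
def ambientπ (a : A) : C.Ambient :=
  ⟨fun R => R.π a, memℓp_infty ⟨‖a‖, by
    rintro _ ⟨R, rfl⟩; exact NonUnitalStarAlgHom.norm_apply_le R.π a⟩⟩

/-- The direct sum of the maps `t` over all covariant representations. -/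
def ambientT (ξ : E) : C.Ambient :=
  ⟨fun R => R.t ξ, memℓp_infty ⟨‖ξ‖, by rintro _ ⟨R, rfl⟩; exact R.norm_t_le ξ⟩⟩

/-- The Cuntz–Pimsner algebra `𝒪(E)`: the C⋆-algebra generated by the universal covariant
representation, which is the direct sum of all covariant representations. -/
def cuntzPimsner : NonUnitalStarSubalgebra ℂ C.Ambient :=
  (NonUnitalStarAlgebra.adjoin ℂ
    (Set.range C.ambientπ ∪ Set.range C.ambientT)).topologicalClosure

instance : IsClosed (C.cuntzPimsner : Set C.Ambient) :=
  NonUnitalStarSubalgebra.isClosed_topologicalClosure _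

theorem ambientπ_mem (a : A) : C.ambientπ a ∈ C.cuntzPimsner :=
  NonUnitalStarSubalgebra.le_topologicalClosure _
    (NonUnitalStarAlgebra.subset_adjoin ℂ _ (Or.inl ⟨a, rfl⟩))

theorem ambientT_mem (ξ : E) : C.ambientT ξ ∈ C.cuntzPimsner :=
  NonUnitalStarSubalgebra.le_topologicalClosure _
    (NonUnitalStarAlgebra.subset_adjoin ℂ _ (Or.inr ⟨ξ, rfl⟩))

/-- The canonical ⋆-homomorphism `A → 𝒪(E)`. -/
def univπ : A →⋆ₙₐ[ℂ] C.cuntzPimsner where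
  toFun a := ⟨C.ambientπ a, C.ambientπ_mem a⟩
  map_smul' c a := Subtype.ext (lp.ext (funext fun R => map_smul R.π c a))
  map_zero' := Subtype.ext (lp.ext (funext fun R => map_zero R.π))
  map_add' a b := Subtype.ext (lp.ext (funext fun R => map_add R.π a b))
  map_mul' a b := Subtype.ext (lp.ext (funext fun R => map_mul R.π a b))
  map_star' a := Subtype.ext (lp.ext (funext fun R => map_star R.π a))

/-- The canonical linear map `E → 𝒪(E)`. -/
def univT : E →ₗ[ℂ] C.cuntzPimsner where
  toFun ξ := ⟨C.ambientT ξ, C.ambientT_mem ξ⟩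
  map_add' ξ η := Subtype.ext (lp.ext (funext fun R => map_add R.t ξ η))
  map_smul' c ξ := Subtype.ext (lp.ext (funext fun R => map_smul R.t c ξ))

/-- The gauge automorphism on the ambient product: it permutes the factors by rotation. -/
def ambientGauge (z : Circle) : C.Ambient →⋆ₙₐ[ℂ] C.Ambient where
  toFun f := ⟨fun R => f (R.rotate z), memℓp_infty ⟨‖f‖, by
    rintro _ ⟨R, rfl⟩
    exact lp.norm_apply_le_norm ENNReal.top_ne_zero f (R.rotate z)⟩⟩
  map_smul' _ _ := rfl
  map_zero' := rfl
  map_add' _ _ := rfl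
  map_mul' _ _ := rfl
  map_star' _ := rfl

theorem ambientGauge_π (z : Circle) (a : A) : C.ambientGauge z (C.ambientπ a) = C.ambientπ a := rfl

theorem ambientGauge_T (z : Circle) (ξ : E) :
    C.ambientGauge z (C.ambientT ξ) = (z : ℂ) • C.ambientT ξ := rfl

theorem norm_ambientGauge_le (z : Circle) (f : C.Ambient) : ‖C.ambientGauge z f‖ ≤ ‖f‖ :=
  NonUnitalStarAlgHom.norm_apply_le (C.ambientGauge z) f

theorem ambientGauge_mem (z : Circle) {f : C.Ambient} (hf : f ∈ C.cuntzPimsner) :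
    C.ambientGauge z f ∈ C.cuntzPimsner := by
  have hcont : Continuous (C.ambientGauge z) :=
    AddMonoidHomClass.continuous_of_bound (C.ambientGauge z) 1
      (by simpa using C.norm_ambientGauge_le z)
  have hle : NonUnitalStarAlgebra.adjoin ℂ (Set.range C.ambientπ ∪ Set.range C.ambientT) ≤
      C.cuntzPimsner.comap (C.ambientGauge z) := by
    refine NonUnitalStarAlgebra.adjoin_le ?_
    rintro _ (⟨a, rfl⟩ | ⟨ξ, rfl⟩)
    · exact C.ambientπ_mem a
    · exact SMulMemClass.smul_mem (z : ℂ) (C.ambientT_mem ξ)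
  exact NonUnitalStarSubalgebra.topologicalClosure_minimal _ hle
    ((NonUnitalStarSubalgebra.isClosed_topologicalClosure _).preimage hcont) hf

/-- The gauge action `σ` of the circle on `𝒪(E)`; it satisfies `σ_z(π(a)) = π(a)` and
`σ_z(t(ξ)) = z t(ξ)`. -/
def gauge (z : Circle) : C.cuntzPimsner →⋆ₙₐ[ℂ] C.cuntzPimsner where
  toFun a := ⟨C.ambientGauge z a, C.ambientGauge_mem z a.2⟩
  map_smul' _ _ := rfl
  map_zero' := rfl
  map_add' _ _ := rfl
  map_mul' _ _ := rfl
  map_star' _ := rfl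

theorem gauge_univπ (z : Circle) (a : A) : C.gauge z (C.univπ a) = C.univπ a := rfl

theorem gauge_univT (z : Circle) (ξ : E) : C.gauge z (C.univT ξ) = (z : ℂ) • C.univT ξ := rfl

/-- The gauge action is point-norm continuous, so the integral below is that of a continuous
function. -/
theorem continuous_gauge (a : C.cuntzPimsner) : Continuous fun z => C.gauge z a := by
  let S : NonUnitalStarSubalgebra ℂ C.Ambient :=
    { carrier := {f | Continuous fun z => C.ambientGauge z f}
      add_mem' := fun {f g} hf hg => by
        have h : Continuous fun z => C.ambientGauge z f + C.ambientGauge z g := hf.add hg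
        exact h
      zero_mem' := by
        have h : Continuous fun _ : Circle => (0 : C.Ambient) := continuous_const
        exact h
      mul_mem' := fun {f g} hf hg => by
        have h : Continuous fun z => C.ambientGauge z f * C.ambientGauge z g := hf.mul hg
        exact h
      smul_mem' := fun c f hf => by
        have h : Continuous fun z => c • C.ambientGauge z f := hf.const_smul c
        exact h
      star_mem' := fun {f} hf => by
        have h : Continuous fun z => star (C.ambientGauge z f) := hf.star
        exact h }
  have hS : IsClosed (S : Set C.Ambient) := by
    refine isClosed_of_closure_subset fun f hf => ?_
    refine continuous_of_uniform_approx_of_continuous fun V hV => ?_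
    obtain ⟨ε, hε, hV⟩ := Metric.mem_uniformity_dist.1 hV
    obtain ⟨g, hg, hfg⟩ := Metric.mem_closure_iff.1 hf ε hε
    refine ⟨fun z => C.ambientGauge z g, hg, fun z => hV ?_⟩
    rw [dist_eq_norm, ← map_sub]
    exact (C.norm_ambientGauge_le z _).trans_lt (by rwa [← dist_eq_norm])
  have hle : NonUnitalStarAlgebra.adjoin ℂ (Set.range C.ambientπ ∪ Set.range C.ambientT) ≤ S := by
    refine NonUnitalStarAlgebra.adjoin_le ?_
    rintro _ (⟨b, rfl⟩ | ⟨ξ, rfl⟩)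
    · have h : Continuous fun _ : Circle => C.ambientπ b := continuous_const
      exact h
    · have h : Continuous fun z : Circle => (z : ℂ) • C.ambientT ξ :=
        continuous_subtype_val.smul continuous_const
      exact h
  have ha : (a : C.Ambient) ∈ S :=
    NonUnitalStarSubalgebra.topologicalClosure_minimal _ hle hS a.2
  exact Continuous.subtype_mk ha _

/-- The gauge conditional expectation `Φ(a) = ∫_𝕋 σ_z(a) dz`, for the normalised Haar measure. -/
def gaugeExpectation (a : C.cuntzPimsner) : C.cuntzPimsner :=
  ∫ s in (0 : ℝ)..1, C.gauge (Circle.exp (2 * Real.pi * s)) a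

end CStarCorrespondence

end Correspondences

/-! ### Crossed products by `ℤ` -/

section CrossedProduct

variable {A : Type u} [CStarAlgebra A] (β : A ≃⋆ₐ[ℂ] A)

/-- A covariant representation of the ℤ-action generated by `β`: a unital representation `π` of `A`
and a unitary `U` implementing `β`. -/
structure CovariantPair where
  /-- the target; the algebra generated by a covariant pair has a copy in the universe of `A` -/
  B : Type u
  [cstar : CStarAlgebra B]
  π : A →⋆ₐ[ℂ] B
  U : unitary B
  implements : ∀ a : A, (U : B) * π a * star (U : B) = π (β a)

attribute [instance] CovariantPair.cstar

/-- The `ℓ^∞`-product of the targets of all covariant pairs. -/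
abbrev CrossedAmbient : Type (u + 1) := lp (fun R : CovariantPair β => R.B) ∞

/-- The direct sum of the maps `π` over all covariant pairs. -/
def crossedAmbientπ (a : A) : CrossedAmbient β :=
  ⟨fun R => R.π a, memℓp_infty ⟨‖a‖, by
    rintro _ ⟨R, rfl⟩; exact NonUnitalStarAlgHom.norm_apply_le R.π a⟩⟩

/-- The direct sum of the implementing unitaries over all covariant pairs. -/
def crossedAmbientU : CrossedAmbient β :=
  ⟨fun R => (R.U : R.B), memℓp_infty ⟨1, by
    rintro _ ⟨R, rfl⟩
    rcases subsingleton_or_nontrivial R.B with h | h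
    · simp [Subsingleton.elim (R.U : R.B) 0]
    · exact (CStarRing.norm_coe_unitary R.U).le⟩⟩

/-- The crossed product `A ⋊_β ℤ`: the C⋆-algebra generated by the universal covariant pair, which is
the direct sum of all covariant pairs. -/
def crossedProduct : NonUnitalStarSubalgebra ℂ (CrossedAmbient β) :=
  (NonUnitalStarAlgebra.adjoin ℂ
    (Set.range (crossedAmbientπ β) ∪ {crossedAmbientU β})).topologicalClosure

instance : IsClosed (crossedProduct β : Set (CrossedAmbient β)) :=
  NonUnitalStarSubalgebra.isClosed_topologicalClosure _

/-- The canonical ⋆-homomorphism `A → A ⋊_β ℤ`. -/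
def crossedπ : A →⋆ₙₐ[ℂ] crossedProduct β where
  toFun a := ⟨crossedAmbientπ β a, NonUnitalStarSubalgebra.le_topologicalClosure _
    (NonUnitalStarAlgebra.subset_adjoin ℂ _ (Or.inl ⟨a, rfl⟩))⟩
  map_smul' c a := Subtype.ext (lp.ext (funext fun R => map_smul R.π c a))
  map_zero' := Subtype.ext (lp.ext (funext fun R => map_zero R.π))
  map_add' a b := Subtype.ext (lp.ext (funext fun R => map_add R.π a b))
  map_mul' a b := Subtype.ext (lp.ext (funext fun R => map_mul R.π a b))
  map_star' a := Subtype.ext (lp.ext (funext fun R => map_star R.π a))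

end CrossedProduct

/-! ### Tracial states, invariant measures, affine maps -/

/-- The tracial states of a C⋆-algebra: positive linear functionals of norm one with
`τ(ab) = τ(ba)`, in the weak-⋆ topology. -/
def tracialStates (A : Type u) [NonUnitalCStarAlgebra A] : Set (WeakDual ℂ A) :=
  {τ | (∀ a : A, 0 ≤ τ (star a * a)) ∧ ‖WeakDual.toStrongDual τ‖ = 1 ∧
    ∀ a b : A, τ (a * b) = τ (b * a)}

/-- The space of `α`-invariant Borel probability measures, in the weak topology. -/
def invariantMeasures {X : Type u} [TopologicalSpace X] [MeasurableSpace X] [BorelSpace X]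
    (α : X ≃ₜ X) : Set (ProbabilityMeasure X) :=
  {μ | (μ : Measure X).map α = μ}

/-- Let `S` and `T` be realised inside `ℝ≥0`-modules by injective maps `i` and `j`. A map `f : S → T`
is affine if convex combinations of points of `S` are again in `S` and are mapped by `f` to the
corresponding convex combinations. -/
def IsAffineVia {S T P Q : Type*} [AddCommMonoid P] [Module ℝ≥0 P] [AddCommMonoid Q] [Module ℝ≥0 Q]
    (f : S → T) (i : S → P) (j : T → Q) : Prop :=
  ∀ (x y : S) (a b : ℝ≥0), a + b = 1 →
    ∃ z : S, i z = a • i x + b • i y ∧ j (f z) = a • j (f x) + b • j (f y)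

/-! ### Hermitian line bundles and their sections -/

section LineBundles

variable {X : Type u} [TopologicalSpace X] (L : X → Type v)
  [∀ x, NormedAddCommGroup (L x)] [∀ x, InnerProductSpace ℂ (L x)]
  [TopologicalSpace (Bundle.TotalSpace ℂ L)] [FiberBundle ℂ L]

/-- A Hermitian structure on a complex line bundle whose fibres carry inner products: the norm is
continuous on the total space. (By polarisation the inner product is then continuous as well.) -/
class IsHermitianLineBundle : Prop where
  continuous_norm : Continuous fun v : Bundle.TotalSpace ℂ L => ‖v.2‖

variable {L}

/-- Continuity of a section `s : X → L`, as a map to the total space. -/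
def IsContSection (s : ∀ x, L x) : Prop :=
  Continuous fun x => (⟨x, s x⟩ : Bundle.TotalSpace ℂ L)

variable [VectorBundle ℂ ℂ L]

theorem isContSection_iff (s : ∀ x, L x) :
    IsContSection s ↔
      ∀ x₀, ContinuousAt (fun x => (trivializationAt ℂ L x₀).linearMapAt ℂ x (s x)) x₀ := by
  unfold IsContSection
  rw [continuous_iff_continuousAt]
  refine forall_congr' fun x₀ => ?_
  rw [FiberBundle.continuousAt_totalSpace]
  simp only [continuousAt_id', true_and]
  refine continuousAt_congr ?_
  filter_upwards [(trivializationAt ℂ L x₀).open_baseSet.mem_nhds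
    (FiberBundle.mem_baseSet_trivializationAt' x₀)] with x hx
  rw [Bundle.Trivialization.coe_linearMapAt_of_mem _ hx]

variable (L) in
/-- The continuous sections of `L`, as a complex vector space. -/
def contSections : Submodule ℂ (∀ x, L x) where
  carrier := {s | IsContSection s}
  add_mem' {s t} hs ht := by
    simp only [Set.mem_ofPred_eq, isContSection_iff] at hs ht ⊢
    intro x₀
    simp only [Pi.add_apply, map_add]
    exact (hs x₀).add (ht x₀)
  zero_mem' := by
    simp only [Set.mem_ofPred_eq, isContSection_iff]
    intro x₀
    simpa using continuousAt_const
  smul_mem' c s hs := by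
    simp only [Set.mem_ofPred_eq, isContSection_iff] at hs ⊢
    intro x₀
    simp only [Pi.smul_apply, map_smul]
    exact (hs x₀).const_smul c

variable (L) in
/-- The space `Γ(L)` of continuous sections. -/
def Sections : Type (max u v) := contSections L

namespace Sections

instance : AddCommGroup (Sections L) := inferInstanceAs (AddCommGroup (contSections L))

instance : Module ℂ (Sections L) := inferInstanceAs (Module ℂ (contSections L))

instance : CoeFun (Sections L) (fun _ => ∀ x, L x) := ⟨fun s => s.1⟩

@[ext]
theorem ext {s t : Sections L} (h : ∀ x, s x = t x) : s = t := Subtype.ext (funext h)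

theorem cont (s : Sections L) : IsContSection (s : ∀ x, L x) := s.2

@[simp] theorem add_apply (s t : Sections L) (x : X) : (s + t) x = s x + t x := rfl

@[simp] theorem sub_apply (s t : Sections L) (x : X) : (s - t) x = s x - t x := rfl

@[simp] theorem zero_apply (x : X) : (0 : Sections L) x = 0 := rfl

@[simp] theorem smul_apply (c : ℂ) (s : Sections L) (x : X) : (c • s) x = c • s x := rfl

/-- Pointwise multiplication of a section by a continuous function. -/
instance : SMul C(X, ℂ) (Sections L) where
  smul f s := ⟨fun x => f x • s x, by
    have hs := s.cont
    change IsContSection _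
    rw [isContSection_iff] at hs ⊢
    intro x₀
    simp only [map_smul]
    exact f.continuous.continuousAt.smul (hs x₀)⟩

@[simp] theorem fun_smul_apply (f : C(X, ℂ)) (s : Sections L) (x : X) : (f • s) x = f x • s x := rfl

instance : Module C(X, ℂ) (Sections L) where
  one_smul s := by ext x; simp
  mul_smul f g s := by ext x; simp [mul_smul]
  smul_zero f := by ext x; simp
  smul_add f s t := by ext x; simp
  add_smul f g s := by ext x; simp [add_smul]
  zero_smul s := by ext x; simp

variable [hL : IsHermitianLineBundle L]

theorem continuous_norm (s : Sections L) : Continuous fun x => ‖s x‖ :=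
  hL.continuous_norm.comp s.cont

theorem continuous_inner (s t : Sections L) : Continuous fun x => inner ℂ (s x) (t x) := by
  have h (r : Sections L) : Continuous fun x => ((‖r x‖ : ℝ) : ℂ) :=
    Complex.continuous_ofReal.comp r.continuous_norm
  have h1 := h (s + t)
  have h2 := h (s - t)
  have h3 := h (s - Complex.I • t)
  have h4 := h (s + Complex.I • t)
  simp only [add_apply, sub_apply, smul_apply] at h1 h2 h3 h4
  simp only [inner_eq_sum_norm_sq_div_four, Complex.coe_algebraMap, RCLike.I_to_complex]
  exact ((((h1.pow 2).sub (h2.pow 2)).add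
    (((h3.pow 2).sub (h4.pow 2)).mul continuous_const)).div_const 4)

/-- The `C(X)`-valued inner product `⟨ξ, η⟩(x) = ⟨ξ(x), η(x)⟩`, linear in `η`. -/
instance : Inner C(X, ℂ) (Sections L) where
  inner s t := ⟨fun x => inner ℂ (s x) (t x), continuous_inner s t⟩

theorem inner_apply (s t : Sections L) (x : X) :
    (inner C(X, ℂ) s t : C(X, ℂ)) x = inner ℂ (s x) (t x) := rfl

variable [CompactSpace X]

instance : Norm (Sections L) := CStarModule.norm C(X, ℂ)

theorem norm_def (s : Sections L) : ‖s‖ = √‖(inner C(X, ℂ) s s : C(X, ℂ))‖ := rfl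

instance : CStarModule C(X, ℂ) (Sections L) where
  inner_add_right := by intros; ext x; simp [inner_apply]
  inner_self_nonneg := by
    intro s x
    change (0 : ℂ) ≤ inner ℂ (s x) (s x)
    rw [inner_self_eq_norm_sq_to_K]
    exact pow_nonneg (by simp) 2
  inner_self := by
    intro s
    constructor
    · intro h
      ext x
      have := DFunLike.congr_fun h x
      rwa [inner_apply, ContinuousMap.zero_apply, inner_self_eq_zero] at this
    · rintro rfl
      ext x
      simp [inner_apply]
  inner_op_smul_right := by intros; ext x; simp [inner_apply]
  inner_smul_right_complex := by intros; ext x; simp [inner_apply]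
  star_inner := by intros; ext x; simp [inner_apply]
  norm_eq_sqrt_norm_inner_self _ := rfl

instance : NormedAddCommGroup (Sections L) :=
  NormedAddCommGroup.ofCore (CStarModule.normedSpaceCore C(X, ℂ))

instance : NormedSpace ℂ (Sections L) :=
  NormedSpace.ofCore (CStarModule.normedSpaceCore C(X, ℂ))

theorem norm_apply_le (s : Sections L) (x : X) : ‖s x‖ ≤ ‖s‖ := by
  rw [norm_def]
  apply Real.le_sqrt_of_sq_le
  calc ‖s x‖ ^ 2 = ‖(inner C(X, ℂ) s s : C(X, ℂ)) x‖ := by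
        rw [inner_apply, inner_self_eq_norm_sq_to_K]; simp
    _ ≤ _ := ContinuousMap.norm_coe_le_norm _ x

theorem norm_le_of_forall {s : Sections L} {c : ℝ} (hc : 0 ≤ c) (h : ∀ x, ‖s x‖ ≤ c) :
    ‖s‖ ≤ c := by
  rw [norm_def]
  refine Real.sqrt_le_iff.2 ⟨hc, (ContinuousMap.norm_le _ (by positivity)).2 fun x => ?_⟩
  rw [inner_apply, inner_self_eq_norm_sq_to_K]
  simpa using pow_le_pow_left₀ (norm_nonneg _) (h x) 2

theorem eventually_trivialization_bound (x₀ : X) : ∃ c : ℝ, 0 < c ∧ ∀ᶠ x in 𝓝 x₀, ∀ v : L x,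
    ‖(trivializationAt ℂ L x₀).linearMapAt ℂ x v‖ ≤ c * ‖v‖ := by
  set e := trivializationAt ℂ L x₀ with he
  have hx₀ : x₀ ∈ e.baseSet := FiberBundle.mem_baseSet_trivializationAt' x₀
  have hnorm : ContinuousAt (fun x => ‖e.symm x (1 : ℂ)‖) x₀ := by
    have h1 : ContinuousOn (fun x => (⟨x, e.symm x 1⟩ : Bundle.TotalSpace ℂ L)) e.baseSet :=
      e.continuousOn_symm.comp (f := fun x => (x, (1 : ℂ))) (by fun_prop)
        (fun x hx => by simpa using hx) |>.congr fun x hx => rfl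
    exact hL.continuous_norm.continuousAt.comp (h1.continuousAt (e.open_baseSet.mem_nhds hx₀))
  have hpos : 0 < ‖e.symm x₀ (1 : ℂ)‖ := by
    rw [norm_pos_iff]
    intro h
    have := e.linearMapAt_symm (R := ℂ) hx₀ (1 : ℂ)
    rw [h] at this
    simp at this
  refine ⟨2 / ‖e.symm x₀ (1 : ℂ)‖, by positivity, ?_⟩
  filter_upwards [hnorm.eventually (lt_mem_nhds (half_lt_self hpos)),
    e.open_baseSet.mem_nhds hx₀] with x hx hxb v
  have hv : v = (e.linearMapAt ℂ x v) • e.symm x (1 : ℂ) := by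
    have h1 := e.symm_linearMapAt (R := ℂ) hxb v
    have h2 : e.symmₗ ℂ x ((e.linearMapAt ℂ x v) • (1 : ℂ)) =
      (e.linearMapAt ℂ x v) • e.symmₗ ℂ x (1 : ℂ) := map_smul _ _ _
    rw [smul_eq_mul, mul_one, e.symmₗ_apply hxb, e.symmₗ_apply hxb, h1] at h2
    exact h2
  have hv' : ‖v‖ = ‖e.linearMapAt ℂ x v‖ * ‖e.symm x (1 : ℂ)‖ := by
    conv_lhs => rw [hv]
    rw [norm_smul]
  rw [hv', div_mul_eq_mul_div, le_div_iff₀ hpos]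
  nlinarith [norm_nonneg (e.linearMapAt ℂ x v)]

instance : CompleteSpace (Sections L) := by
  refine Metric.complete_of_cauchySeq_tendsto fun s hs => ?_
  have hcomp (x : X) : CompleteSpace (L x) := by
    have : FiniteDimensional ℂ (L x) :=
      ((trivializationAt ℂ L x).continuousLinearEquivAt ℂ x
        (FiberBundle.mem_baseSet_trivializationAt' x)).symm.toLinearEquiv.finiteDimensional
    exact FiniteDimensional.complete ℂ (L x)
  rw [Metric.cauchySeq_iff] at hs
  have hdist (m n : ℕ) (x : X) : ‖s m x - s n x‖ ≤ dist (s m) (s n) := by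
    rw [dist_eq_norm, ← sub_apply]
    exact norm_apply_le _ _
  have hptw (x : X) : ∃ l, Filter.Tendsto (fun n => s n x) Filter.atTop (𝓝 l) := by
    refine cauchySeq_tendsto_of_complete (Metric.cauchySeq_iff.2 fun ε hε => ?_)
    obtain ⟨N, hN⟩ := hs ε hε
    refine ⟨N, fun m hm n hn => ?_⟩
    rw [dist_eq_norm]
    exact (hdist m n x).trans_lt (hN m hm n hn)
  choose l hl using hptw
  have hunif : ∀ ε > 0, ∃ N, ∀ n ≥ N, ∀ x, ‖s n x - l x‖ ≤ ε := by
    intro ε hε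
    obtain ⟨N, hN⟩ := hs ε hε
    refine ⟨N, fun n hn x => ?_⟩
    have ht : Filter.Tendsto (fun m => ‖s n x - s m x‖) Filter.atTop (𝓝 ‖s n x - l x‖) :=
      (tendsto_const_nhds.sub (hl x)).norm
    refine le_of_tendsto ht ?_
    filter_upwards [Filter.eventually_ge_atTop N] with m hm
    exact (hdist n m x).trans (hN n hn m hm).le
  have hcont : IsContSection l := by
    rw [isContSection_iff]
    intro x₀
    obtain ⟨c, hc, hbound⟩ := eventually_trivialization_bound (L := L) x₀
    rw [Metric.continuousAt_iff']
    intro ε hε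
    obtain ⟨N, hN⟩ := hunif (ε / (4 * c)) (by positivity)
    have h1 := (Metric.continuousAt_iff'.1 ((isContSection_iff _).1 (s N).cont x₀)) (ε / 3)
      (by positivity)
    have key : ∀ x, (∀ v : L x, ‖(trivializationAt ℂ L x₀).linearMapAt ℂ x v‖ ≤ c * ‖v‖) →
        ‖(trivializationAt ℂ L x₀).linearMapAt ℂ x (s N x) -
          (trivializationAt ℂ L x₀).linearMapAt ℂ x (l x)‖ ≤ ε / 4 := by
      intro x hx
      rw [← map_sub]
      calc _ ≤ c * ‖s N x - l x‖ := hx _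
        _ ≤ c * (ε / (4 * c)) := by gcongr; exact hN N le_rfl x
        _ = ε / 4 := by field_simp
    filter_upwards [h1, hbound] with x hx1 hx2
    have k1 := key x hx2
    have k2 := key x₀ hbound.self_of_nhds
    rw [← dist_eq_norm] at k1 k2
    rw [dist_comm] at k1
    have k3 := dist_triangle4 ((trivializationAt ℂ L x₀).linearMapAt ℂ x (l x))
      ((trivializationAt ℂ L x₀).linearMapAt ℂ x (s N x))
      ((trivializationAt ℂ L x₀).linearMapAt ℂ x₀ (s N x₀))
      ((trivializationAt ℂ L x₀).linearMapAt ℂ x₀ (l x₀))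
    linarith
  let l' : Sections L := ⟨l, hcont⟩
  refine ⟨l', Metric.tendsto_atTop.2 fun ε hε => ?_⟩
  obtain ⟨N, hN⟩ := hunif (ε / 2) (by positivity)
  refine ⟨N, fun n hn => ?_⟩
  rw [dist_eq_norm]
  exact (norm_le_of_forall (by positivity) fun x => hN n hn x).trans_lt (half_lt_self hε)

end Sections

variable [CompactSpace X] [IsHermitianLineBundle L]

variable (L) in
/-- The correspondence `Γ(L, α)` over `C(X)`: the right Hilbert module `Γ(L)` with the left action
`f ξ = ξ (f ∘ α)`. -/
def sectionCorrespondence (α : X ≃ₜ X) : CStarCorrespondence C(X, ℂ) (Sections L) where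
  φ :=
    { toFun := fun f => LinearMap.mkContinuous
        { toFun := fun ξ => (f.comp (α : C(X, X)) : C(X, ℂ)) • ξ
          map_add' := fun ξ η => smul_add _ _ _
          map_smul' := fun c ξ => by ext x; exact smul_comm _ _ _ }
        ‖(f.comp (α : C(X, X)) : C(X, ℂ))‖ (fun ξ => CStarModule.norm_smul_le' _ _)
      map_smul' := fun c f => by
        ext ξ x
        simp [mul_smul]
      map_zero' := by ext ξ x; simp
      map_add' := fun f g => by
        ext ξ x
        simp [add_smul]
      map_mul' := fun f g => by
        ext ξ x
        simp [mul_smul] }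
  inner_φ_left f ξ η := by
    ext x
    change inner ℂ (f (α x) • ξ x) (η x) = inner ℂ (ξ x) (star f (α x) • η x)
    rw [_root_.inner_smul_left, _root_.inner_smul_right]
    rfl

theorem sectionCorrespondence_apply (α : X ≃ₜ X) (f : C(X, ℂ)) (ξ : Sections L) (x : X) :
    ((sectionCorrespondence L α).φ f ξ) x = f (α x) • ξ x := rfl

end LineBundles

end

/-!
Both algebras are generated by an isometric copy `π` of `C(X)` and by elements `t(ξ)` of degree one
for a circle action such that `t(ξ)^* t(η)` and `t(ξ) t(η)^*` lie in `π(C(X))` and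
`π(f) t(ξ) = t(ξ) π(f ∘ α)`: for the crossed product the only generator of degree one is the
implementing unitary, with the dual action; for `𝒪(Γ(L, α))` they are indexed by the sections. The
structure `GaugeSystem` records this, and the theorem is proved for it.

Words in the generators span a dense subspace and can be sorted by degree
(`GaugeSystem.mem_of_homogeneous_le`). A word of degree zero is a function, so the gauge expectation
`Φ` is `C(X)`-valued (`GaugeSystem.expect_mem_range`). If `b` has degree `n ≠ 0`, then
`π(f) b = b π(f ∘ αⁿ)`, so for a trace `τ` the functional `f ↦ τ(b π(f))` annihilates the ideal
generated by all `f - f ∘ αⁿ`, which has no common zero as `αⁿ` has no fixed point; therefore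
`τ(b) = 0` and `τ = τ ∘ Φ` (`GaugeSystem.trace_eq_trace_expect`). So `τ` is determined by the measure
`μ` that represents `τ ∘ π`. With a frame `∑ ⟨ξᵢ, ξᵢ⟩ = 1` one has
`π(f) = ∑ π(f) t(ξᵢ) t(ξᵢ)^*`, and the trace property turns this into `μ(f) = μ(f ∘ α)`
(`GaugeSystem.exists_invariantMeasure`). Conversely `a ↦ ∫ π⁻¹(Φ(a)) dμ` is a tracial state when `μ`
is invariant (`GaugeSystem.traceOf_mem_tracialStates`). Continuity in both directions is immediate
from the definitions of the two weak topologies.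

What remains is to see that the two universal algebras are such systems. Since the fibres of `L` are
one-dimensional, a rank one operator on `Γ(L)` is the left action of a function (`φ_eq_rankOneOp`),
and Katsura's covariance condition says that `t(ξ) t(η)^* = π(⟨η, ξ⟩ ∘ α⁻¹)`. Frames come from
local trivializations and compactness (`Sections.exists_frame`). The map `π` is isometric because the
multiplication operators on `ℓ²(X)`, for the discrete set `X`, belong to a covariant representation:
`u` acts by the permutation `α`, and `t(ξ)` by multiplication with the coordinates of `ξ` in an
arbitrary, possibly discontinuous, field of unit vectors, followed by that permutation
(`ellTwoPair`, `ellTwoRep`).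
-/

noncomputable section

set_option linter.unusedSectionVars false

/-! ### Gauge systems over a homeomorphism -/

/-- The data shared by the Cuntz–Pimsner algebra of `Γ(L, α)` and the crossed product `C(X) ⋊_α ℤ`:
a C⋆-algebra `O` generated by an isometric copy `π` of `C(X)` and by elements `t ξ` of degree one,
on which the circle acts. The products `t(ξ)^* t(η)` and `t(ξ) t(η)^*` are functions determined by
`ip ξ η`, and `frame` is a finite partition of unity `∑ ⟨ξᵢ, ξᵢ⟩ = 1`. -/
structure GaugeSystem {X : Type u} [TopologicalSpace X] [CompactSpace X] (α : X ≃ₜ X)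
    (O : Type v) [NonUnitalCStarAlgebra O] where
  /-- the copy of `C(X)` -/
  π : C(X, ℂ) →⋆ₙₐ[ℂ] O
  norm_π : ∀ f, ‖π f‖ = ‖f‖
  /-- the index set of the generators of degree one -/
  ι : Type w
  /-- the generators of degree one -/
  t : ι → O
  /-- the inner product of two generators -/
  ip : ι → ι → C(X, ℂ)
  star_t_mul_t : ∀ ξ η, star (t ξ) * t η = π (ip ξ η)
  t_mul_star_t : ∀ ξ η, t ξ * star (t η) = π ((ip η ξ).comp (α.symm : C(X, X)))
  π_mul_t : ∀ f ξ, π f * t ξ = t ξ * π (f.comp (α : C(X, X)))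
  /-- the number of elements of the frame -/
  n : ℕ
  /-- the frame -/
  frame : Fin n → ι
  sum_ip_frame : ∑ i, ip (frame i) (frame i) = 1
  generates : ∀ S : NonUnitalStarSubalgebra ℂ O, IsClosed (S : Set O) →
    (∀ f, π f ∈ S) → (∀ ξ, t ξ ∈ S) → ∀ a, a ∈ S
  /-- the gauge action -/
  σ : Circle → O →⋆ₙₐ[ℂ] O
  σ_π : ∀ z f, σ z (π f) = π f
  σ_t : ∀ z ξ, σ z (t ξ) = (z : ℂ) • t ξ

namespace GaugeSystem

variable {X : Type u} [TopologicalSpace X] [CompactSpace X] {α : X ≃ₜ X}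
  {O : Type v} [NonUnitalCStarAlgebra O] (S : GaugeSystem.{u, v, w} α O)

theorem induction {p : O → Prop} (hp : IsClosed {a | p a}) (hπ : ∀ f, p (S.π f))
    (ht : ∀ ξ, p (S.t ξ)) (ht' : ∀ ξ, p (star (S.t ξ))) (h0 : p 0)
    (hadd : ∀ a b, p a → p b → p (a + b)) (hsmul : ∀ (c : ℂ) a, p a → p (c • a))
    (hmul : ∀ a b, p a → p b → p (a * b)) (a : O) : p a := by
  let T : NonUnitalStarSubalgebra ℂ O :=
    { carrier := {a | p a ∧ p (star a)}
      add_mem' := fun {a b} ha hb => ⟨hadd _ _ ha.1 hb.1, by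
        rw [star_add]; exact hadd _ _ ha.2 hb.2⟩
      zero_mem' := ⟨h0, by simpa using h0⟩
      mul_mem' := fun {a b} ha hb => ⟨hmul _ _ ha.1 hb.1, by
        rw [star_mul]; exact hmul _ _ hb.2 ha.2⟩
      smul_mem' := fun c a ha => ⟨hsmul _ _ ha.1, by rw [star_smul]; exact hsmul _ _ ha.2⟩
      star_mem' := fun {a} ha => ⟨ha.2, by rw [star_star]; exact ha.1⟩ }
  have hT : IsClosed (T : Set O) := hp.inter (hp.preimage continuous_star)
  exact (S.generates T hT (fun f => ⟨hπ f, by rw [← map_star]; exact hπ _⟩)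
    (fun ξ => ⟨ht ξ, ht' ξ⟩) a).1

/-- Point-norm continuity of the gauge action follows from its continuity on the generators. -/
theorem continuous_σ (a : O) : Continuous fun z => S.σ z a := by
  induction a using S.induction with
  | hp =>
    refine isClosed_of_closure_subset fun a ha => ?_
    refine continuous_of_uniform_approx_of_continuous fun V hV => ?_
    obtain ⟨ε, hε, hV⟩ := Metric.mem_uniformity_dist.1 hV
    obtain ⟨b, hb, hab⟩ := Metric.mem_closure_iff.1 ha ε hε
    refine ⟨fun z => S.σ z b, hb, fun z => hV ?_⟩
    rw [dist_eq_norm, ← map_sub]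
    exact (NonUnitalStarAlgHom.norm_apply_le _ _).trans_lt (by rwa [← dist_eq_norm])
  | hπ f =>
    simp only [S.σ_π]
    exact continuous_const
  | ht ξ =>
    simp only [S.σ_t]
    exact continuous_subtype_val.smul continuous_const
  | ht' ξ =>
    simp only [map_star, S.σ_t]
    exact (continuous_subtype_val.smul continuous_const).star
  | h0 =>
    simp only [map_zero]
    exact continuous_const
  | hadd a b ha hb =>
    simp only [map_add]
    exact ha.add hb
  | hsmul c a ha =>
    simp only [map_smul]
    exact ha.const_smul c
  | hmul a b ha hb =>
    simp only [map_mul]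
    exact ha.mul hb

/-- `π 1` is the unit of `O`; for `t(ξ) π(1) = t(ξ)` this is the C⋆-identity applied to the
difference. -/
theorem π_one_mul_and_mul_π_one (a : O) : S.π 1 * a = a ∧ a * S.π 1 = a := by
  have h1 (ξ : S.ι) : S.t ξ * S.π 1 = S.t ξ := by
    rw [← sub_eq_zero, ← CStarRing.star_mul_self_eq_zero_iff]
    have h : star (S.π 1) = S.π 1 := by rw [← map_star, star_one]
    simp only [star_sub, star_mul, h, mul_sub, sub_mul]
    simp only [mul_assoc, S.star_t_mul_t]
    simp only [← mul_assoc, S.star_t_mul_t, ← map_mul, mul_one, one_mul]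
    simp
  have h2 (ξ : S.ι) : S.π 1 * S.t ξ = S.t ξ := by
    rw [S.π_mul_t]
    exact h1 ξ
  have hs : star (S.π 1) = S.π 1 := by rw [← map_star, star_one]
  induction a using S.induction with
  | hp =>
    exact (isClosed_eq (by fun_prop) continuous_id).inter
      (isClosed_eq (by fun_prop) continuous_id)
  | hπ f => exact ⟨by rw [← map_mul, one_mul], by rw [← map_mul, mul_one]⟩
  | ht ξ => exact ⟨h2 ξ, h1 ξ⟩
  | ht' ξ => exact ⟨by simpa [hs] using congrArg star (h1 ξ), by
      simpa [hs] using congrArg star (h2 ξ)⟩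
  | h0 => simp
  | hadd a b ha hb => simp [mul_add, add_mul, ha, hb]
  | hsmul c a ha => exact ⟨by rw [mul_smul_comm, ha.1], by rw [smul_mul_assoc, ha.2]⟩
  | hmul a b ha hb => exact ⟨by rw [← mul_assoc, ha.1], by rw [mul_assoc, hb.2]⟩

theorem π_one_mul (a : O) : S.π 1 * a = a := (S.π_one_mul_and_mul_π_one a).1

theorem mul_π_one (a : O) : a * S.π 1 = a := (S.π_one_mul_and_mul_π_one a).2

theorem π_injective : Function.Injective S.π := by
  intro f g h
  rw [← sub_eq_zero, ← norm_eq_zero, ← S.norm_π, map_sub, h, sub_self, norm_zero]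

theorem sum_frame_mul_star : ∑ i, S.t (S.frame i) * star (S.t (S.frame i)) = S.π 1 := by
  simp only [S.t_mul_star_t, ← map_sum]
  congr 1
  ext x
  have := DFunLike.congr_fun S.sum_ip_frame (α.symm x)
  simpa using this

theorem sum_star_frame_mul : ∑ i, star (S.t (S.frame i)) * S.t (S.frame i) = S.π 1 := by
  simp only [S.star_t_mul_t, ← map_sum, S.sum_ip_frame]

theorem star_t_mul_π (f : C(X, ℂ)) (ξ : S.ι) :
    star (S.t ξ) * S.π f = S.π (f.comp (α : C(X, X))) * star (S.t ξ) := by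
  have h := congrArg star (S.π_mul_t (star f) ξ)
  rw [star_mul, star_mul, ← map_star, ← map_star, star_star] at h
  have hf : star ((star f).comp (α : C(X, X))) = f.comp (α : C(X, X)) := by ext x; simp
  rwa [hf] at h

/-! ### Homogeneous elements -/

/-- The elements that `n`-fold left multiplication by elements of the family `s` carries to
`π(C(X))`. -/
def descent {κ : Type*} (s : κ → O) : ℕ → Submodule ℂ O
  | 0 => LinearMap.range (S.π : C(X, ℂ) →ₗ[ℂ] O)
  | n + 1 =>
    { carrier := {b | ∀ ξ, s ξ * b ∈ descent s n}
      add_mem' := fun ha hb ξ => by rw [mul_add]; exact add_mem (ha ξ) (hb ξ)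
      zero_mem' := fun ξ => by rw [mul_zero]; exact zero_mem _
      smul_mem' := fun c b hb ξ => by rw [mul_smul_comm]; exact Submodule.smul_mem _ c (hb ξ) }

/-- The elements that become functions after `n` left multiplications by elements `t(ξ)^*` if
`n ≥ 0`, and after `-n` left multiplications by elements `t(ξ)` if `n ≤ 0`. Left multiplication by a
generator shifts `n` by the degree of the generator, and `descentInt 0` is `π(C(X))`. -/
def descentInt : ℤ → Submodule ℂ O
  | Int.ofNat n => S.descent (fun ξ => star (S.t ξ)) n
  | Int.negSucc n => S.descent S.t (n + 1)

theorem π_mul_mem_descent_star (n : ℕ) (f : C(X, ℂ)) {b : O}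
    (hb : b ∈ S.descent (fun ξ => star (S.t ξ)) n) :
    S.π f * b ∈ S.descent (fun ξ => star (S.t ξ)) n := by
  induction n generalizing f b with
  | zero =>
    obtain ⟨g, rfl⟩ := hb
    exact ⟨f * g, map_mul S.π f g⟩
  | succ n ih =>
    intro ξ
    rw [← mul_assoc, S.star_t_mul_π, mul_assoc]
    exact ih _ (hb ξ)

theorem π_mul_mem_descent_t (n : ℕ) (f : C(X, ℂ)) {b : O} (hb : b ∈ S.descent S.t n) :
    S.π f * b ∈ S.descent S.t n := by
  induction n generalizing f b with
  | zero =>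
    obtain ⟨g, rfl⟩ := hb
    exact ⟨f * g, map_mul S.π f g⟩
  | succ n ih =>
    intro ξ
    have h := S.π_mul_t (f.comp (α.symm : C(X, X))) ξ
    have hf : (f.comp (α.symm : C(X, X))).comp (α : C(X, X)) = f := by ext x; simp
    rw [hf] at h
    rw [← mul_assoc, ← h, mul_assoc]
    exact ih _ (hb ξ)

theorem π_mul_mem_descentInt (n : ℤ) (f : C(X, ℂ)) {b : O} (hb : b ∈ S.descentInt n) :
    S.π f * b ∈ S.descentInt n := by
  cases n with
  | ofNat n => exact S.π_mul_mem_descent_star n f hb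
  | negSucc n => exact S.π_mul_mem_descent_t _ f hb

theorem t_mul_mem_descentInt (n : ℤ) (ξ : S.ι) {b : O} (hb : b ∈ S.descentInt n) :
    S.t ξ * b ∈ S.descentInt (n + 1) := by
  cases n with
  | ofNat n =>
    intro η
    rw [← mul_assoc, S.star_t_mul_t]
    exact S.π_mul_mem_descent_star n _ hb
  | negSucc n =>
    cases n with
    | zero => exact hb ξ
    | succ n => exact hb ξ

theorem star_t_mul_mem_descentInt (n : ℤ) (ξ : S.ι) {b : O} (hb : b ∈ S.descentInt n) :
    star (S.t ξ) * b ∈ S.descentInt (n - 1) := by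
  have key (m : ℕ) (hb : b ∈ S.descent S.t m) :
      star (S.t ξ) * b ∈ S.descent S.t (m + 1) := by
    intro η
    rw [← mul_assoc, S.t_mul_star_t]
    exact S.π_mul_mem_descent_t m _ hb
  cases n with
  | ofNat n =>
    cases n with
    | zero => exact key 0 hb
    | succ n =>
      have h := hb ξ
      have e : Int.ofNat (n + 1) - 1 = Int.ofNat n := by
        simp
      rw [e]
      exact h
  | negSucc n => exact key (n + 1) hb

/-- The elements of degree `n` for the gauge action that lie in `descentInt n` and intertwine
`f` with `f ∘ α ^ n`. All three conditions are linear and compatible with left multiplication by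
generators, so that words in the generators are homogeneous in this sense. -/
def homogeneous (n : ℤ) : Submodule ℂ O where
  carrier := {b | b ∈ S.descentInt n ∧ (∀ z : Circle, S.σ z b = ((z ^ n : Circle) : ℂ) • b) ∧
    ∀ f : C(X, ℂ), S.π f * b = b * S.π (f.comp ((α ^ n : X ≃ₜ X) : C(X, X)))}
  add_mem' ha hb := ⟨add_mem ha.1 hb.1, fun z => by rw [map_add, ha.2.1, hb.2.1, smul_add],
    fun f => by rw [mul_add, add_mul, ha.2.2, hb.2.2]⟩
  zero_mem' := ⟨zero_mem _, fun z => by simp, fun f => by simp⟩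
  smul_mem' c b hb := ⟨Submodule.smul_mem _ c hb.1,
    fun z => by rw [map_smul, hb.2.1, smul_comm],
    fun f => by rw [mul_smul_comm, smul_mul_assoc, hb.2.2]⟩

theorem π_mem_homogeneous (f : C(X, ℂ)) : S.π f ∈ S.homogeneous 0 :=
  ⟨⟨f, rfl⟩, fun z => by simp [S.σ_π], fun g => by
    rw [← map_mul, mul_comm, map_mul]; rfl⟩

theorem π_mul_mem_homogeneous {n : ℤ} (f : C(X, ℂ)) {b : O} (hb : b ∈ S.homogeneous n) :
    S.π f * b ∈ S.homogeneous n :=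
  ⟨S.π_mul_mem_descentInt n f hb.1, fun z => by rw [map_mul, S.σ_π, hb.2.1, mul_smul_comm],
    fun g => by
      rw [← mul_assoc, ← map_mul, mul_comm, map_mul, mul_assoc, hb.2.2 g, mul_assoc]⟩

theorem t_mul_mem_homogeneous {n : ℤ} (ξ : S.ι) {b : O} (hb : b ∈ S.homogeneous n) :
    S.t ξ * b ∈ S.homogeneous (n + 1) := by
  refine ⟨S.t_mul_mem_descentInt n ξ hb.1, fun z => ?_, fun g => ?_⟩
  · rw [map_mul, S.σ_t, hb.2.1, smul_mul_smul_comm, add_comm, zpow_one_add, Circle.coe_mul]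
  · rw [← mul_assoc, S.π_mul_t, mul_assoc, hb.2.2, mul_assoc, add_comm, zpow_one_add]
    rfl

theorem star_t_mul_mem_homogeneous {n : ℤ} (ξ : S.ι) {b : O} (hb : b ∈ S.homogeneous n) :
    star (S.t ξ) * b ∈ S.homogeneous (n - 1) := by
  refine ⟨S.star_t_mul_mem_descentInt n ξ hb.1, fun z => ?_, fun g => ?_⟩
  · rw [map_mul, map_star, S.σ_t, hb.2.1, star_smul, smul_mul_smul_comm, sub_eq_neg_add,
      zpow_add, zpow_neg_one, Circle.coe_mul, Circle.coe_inv_eq_conj]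
    rfl
  · have h := S.star_t_mul_π (g.comp (α.symm : C(X, X))) ξ
    have hg : (g.comp (α.symm : C(X, X))).comp (α : C(X, X)) = g := by ext x; simp
    rw [hg] at h
    rw [← mul_assoc, ← h, mul_assoc, hb.2.2, mul_assoc, sub_eq_neg_add, zpow_add, zpow_neg_one]
    rfl

/-- The homogeneous elements span a dense subspace. -/
theorem mem_of_homogeneous_le {W : Submodule ℂ O} (hW : IsClosed (W : Set O))
    (h : ∀ n, S.homogeneous n ≤ W) (a : O) : a ∈ W := by
  let V : Submodule ℂ O := ⨆ n, S.homogeneous n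
  have hVW : closure (V : Set O) ⊆ W := closure_minimal (iSup_le h) hW
  have hshift (c : O) (d : ℤ) (hc : ∀ n, ∀ b ∈ S.homogeneous n, c * b ∈ S.homogeneous (n + d)) :
      ∀ b ∈ closure (V : Set O), c * b ∈ closure (V : Set O) := by
    intro b hb
    refine map_mem_closure (f := fun b => c * b) (by fun_prop) hb ?_
    have : V ≤ V.comap (LinearMap.mulLeft ℂ c) :=
      iSup_le fun n b hb => Submodule.mem_iSup_of_mem (n + d) (hc n b hb)
    exact this
  -- the closed span of the homogeneous elements is a left ideal containing the unit `π 1`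
  have key : ∀ b ∈ closure (V : Set O), a * b ∈ closure (V : Set O) := by
    induction a using S.induction with
    | hp =>
      simp only [Set.ofPred_forall]
      exact isClosed_biInter fun b _ => isClosed_closure.preimage (by fun_prop)
    | hπ f => exact hshift _ 0 fun n b hb => by rw [add_zero]; exact S.π_mul_mem_homogeneous f hb
    | ht ξ => exact hshift _ 1 fun n b hb => S.t_mul_mem_homogeneous ξ hb
    | ht' ξ => exact hshift _ (-1) fun n b hb => S.star_t_mul_mem_homogeneous ξ hb
    | h0 =>
      intro b _
      rw [zero_mul]
      exact V.topologicalClosure.zero_mem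
    | hadd a c ha hc =>
      intro b hb
      rw [add_mul]
      exact V.topologicalClosure.add_mem (ha b hb) (hc b hb)
    | hsmul z a ha =>
      intro b hb
      rw [smul_mul_assoc]
      exact V.topologicalClosure.smul_mem z (ha b hb)
    | hmul a c ha hc =>
      intro b hb
      rw [mul_assoc]
      exact ha _ (hc b hb)
  have h1 : S.π 1 ∈ closure (V : Set O) :=
    subset_closure (Submodule.mem_iSup_of_mem 0 (S.π_mem_homogeneous 1))
  have := key _ h1
  rw [S.mul_π_one] at this
  exact hVW this

/-! ### The conditional expectation -/

/-- The gauge expectation `Φ(a) = ∫ σ_z(a) dz`. -/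
def expect (a : O) : O := ∫ s in (0 : ℝ)..1, S.σ (Circle.exp (2 * Real.pi * s)) a

theorem continuous_σ_exp (a : O) :
    Continuous fun s : ℝ => S.σ (Circle.exp (2 * Real.pi * s)) a :=
  (S.continuous_σ a).comp (Circle.exp.continuous.comp (by fun_prop))

theorem expect_add (a b : O) : S.expect (a + b) = S.expect a + S.expect b := by
  simp only [expect, map_add]
  exact intervalIntegral.integral_add ((S.continuous_σ_exp a).intervalIntegrable _ _)
    ((S.continuous_σ_exp b).intervalIntegrable _ _)

theorem expect_smul (c : ℂ) (a : O) : S.expect (c • a) = c • S.expect a := by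
  simp only [expect, map_smul]
  exact intervalIntegral.integral_smul _ _

theorem norm_expect_le (a : O) : ‖S.expect a‖ ≤ ‖a‖ := by
  have h := intervalIntegral.norm_integral_le_of_norm_le_const (a := (0 : ℝ)) (b := 1)
    (f := fun s => S.σ (Circle.exp (2 * Real.pi * s)) a) (C := ‖a‖)
    fun s _ => NonUnitalStarAlgHom.norm_apply_le _ a
  simpa [expect] using h

/-- The gauge expectation as a bounded operator. -/
def expectCLM : O →L[ℂ] O :=
  LinearMap.mkContinuous { toFun := S.expect, map_add' := S.expect_add, map_smul' := S.expect_smul }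
    1 fun a => by rw [one_mul]; exact S.norm_expect_le a

theorem continuous_expect : Continuous S.expect := S.expectCLM.continuous

/-- `Φ` commutes with bounded operators that commute with the gauge action. -/
theorem expect_comp_comm (T : O →L[ℂ] O) (hT : ∀ z a, S.σ z (T a) = T (S.σ z a)) (a : O) :
    S.expect (T a) = T (S.expect a) := by
  simp only [expect, hT]
  exact T.intervalIntegral_comp_comm ((S.continuous_σ_exp a).intervalIntegrable _ _)

theorem expect_of_fixed {a : O} (h : ∀ z, S.σ z a = a) : S.expect a = a := by
  simp [expect, h]

theorem expect_π (f : C(X, ℂ)) : S.expect (S.π f) = S.π f := S.expect_of_fixed fun z => S.σ_π z f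

theorem expect_of_mem_homogeneous {n : ℤ} (hn : n ≠ 0) {b : O} (hb : b ∈ S.homogeneous n) :
    S.expect b = 0 := by
  have hc : (2 * Real.pi * n * Complex.I : ℂ) ≠ 0 := by
    simp [hn, Real.pi_ne_zero]
  have h (s : ℝ) : S.σ (Circle.exp (2 * Real.pi * s)) b =
      Complex.exp (2 * Real.pi * n * Complex.I * s) • b := by
    rw [hb.2.1, Circle.coe_zpow, Circle.coe_exp, ← Complex.exp_int_mul]
    congr 2
    push_cast
    ring
  simp only [expect, h]
  rw [intervalIntegral.integral_smul_const, integral_exp_mul_complex hc]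
  have : Complex.exp (2 * Real.pi * n * Complex.I * (1 : ℝ)) = 1 := by
    rw [← Complex.exp_int_mul_two_pi_mul_I n]
    congr 1
    push_cast
    ring
  rw [this]
  simp

theorem isClosed_range_π : IsClosed (LinearMap.range (S.π : C(X, ℂ) →ₗ[ℂ] O) : Set O) := by
  have : Isometry S.π := AddMonoidHomClass.isometry_of_norm S.π S.norm_π
  exact this.isClosedEmbedding.isClosed_range

/-- The expectation is `C(X)`-valued: homogeneous elements of degree zero are functions and those of
other degrees are annihilated. -/
theorem expect_mem_range (a : O) : S.expect a ∈ Set.range S.π := by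
  let W : Submodule ℂ O := (LinearMap.range (S.π : C(X, ℂ) →ₗ[ℂ] O)).comap (S.expectCLM : O →ₗ[ℂ] O)
  refine S.mem_of_homogeneous_le (W := W) (S.isClosed_range_π.preimage S.continuous_expect) ?_ a
  intro n b hb
  change S.expect b ∈ LinearMap.range (S.π : C(X, ℂ) →ₗ[ℂ] O)
  rcases eq_or_ne n 0 with rfl | hn
  · rw [S.expect_of_fixed fun z => by simpa using hb.2.1 z]
    exact hb.1
  · rw [S.expect_of_mem_homogeneous hn hb]
    exact zero_mem _

/-- The function `π⁻¹(Φ(a))`. -/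
def coeff (a : O) : C(X, ℂ) := (S.expect_mem_range a).choose

theorem π_coeff (a : O) : S.π (S.coeff a) = S.expect a := (S.expect_mem_range a).choose_spec

theorem coeff_eq_of {a : O} {f : C(X, ℂ)} (h : S.expect a = S.π f) : S.coeff a = f :=
  S.π_injective ((S.π_coeff a).trans h)

theorem coeff_π (f : C(X, ℂ)) : S.coeff (S.π f) = f := S.coeff_eq_of (S.expect_π f)

theorem coeff_add (a b : O) : S.coeff (a + b) = S.coeff a + S.coeff b :=
  S.coeff_eq_of (by rw [expect_add, map_add, π_coeff, π_coeff])

theorem coeff_smul (c : ℂ) (a : O) : S.coeff (c • a) = c • S.coeff a :=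
  S.coeff_eq_of (by rw [expect_smul, map_smul, π_coeff])

theorem norm_coeff_le (a : O) : ‖S.coeff a‖ ≤ ‖a‖ := by
  rw [← S.norm_π, S.π_coeff]
  exact S.norm_expect_le a

theorem coeff_star (a : O) : S.coeff (star a) = star (S.coeff a) := by
  refine S.coeff_eq_of ?_
  rw [map_star, S.π_coeff]
  simp only [expect, map_star]
  exact ((starL' ℝ : O ≃L[ℝ] O) : O →L[ℝ] O).intervalIntegral_comp_comm
    ((S.continuous_σ_exp a).intervalIntegrable _ _)

theorem coeff_π_mul (f : C(X, ℂ)) (a : O) : S.coeff (S.π f * a) = f * S.coeff a := by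
  refine S.coeff_eq_of ?_
  rw [map_mul, S.π_coeff]
  exact S.expect_comp_comm (ContinuousLinearMap.mul ℂ O (S.π f))
    (fun z b => by simp [S.σ_π]) a

theorem coeff_mul_π (a : O) (f : C(X, ℂ)) : S.coeff (a * S.π f) = S.coeff a * f := by
  refine S.coeff_eq_of ?_
  rw [map_mul, S.π_coeff]
  exact S.expect_comp_comm ((ContinuousLinearMap.mul ℂ O).flip (S.π f))
    (fun z b => by simp [S.σ_π]) a

theorem coeff_t_mul_mul_star_t (ξ η : S.ι) (a : O) :
    S.coeff (S.t ξ * a * star (S.t η)) =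
      (S.coeff a * S.ip η ξ).comp (α.symm : C(X, X)) := by
  refine S.coeff_eq_of ?_
  have h := S.expect_comp_comm (((ContinuousLinearMap.mul ℂ O).flip (star (S.t η))).comp
    (ContinuousLinearMap.mul ℂ O (S.t ξ))) (fun z b => by
      have hz : (z : ℂ) * (starRingEnd ℂ) (z : ℂ) = 1 := by
        rw [mul_comm, ← Complex.normSq_eq_conj_mul_self]; simp
      simp only [ContinuousLinearMap.comp_apply, ContinuousLinearMap.flip_apply,
        ContinuousLinearMap.mul_apply', map_mul, map_star, S.σ_t, star_smul, smul_mul_assoc,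
        mul_smul_comm, smul_smul]
      rw [mul_comm, RCLike.star_def, hz, one_smul]) a
  simp only [ContinuousLinearMap.comp_apply, ContinuousLinearMap.flip_apply,
    ContinuousLinearMap.mul_apply'] at h
  have h2 := S.π_mul_t ((S.coeff a).comp (α.symm : C(X, X))) ξ
  have hf : ((S.coeff a).comp (α.symm : C(X, X))).comp (α : C(X, X)) = S.coeff a := by
    ext x; simp
  rw [hf] at h2
  rw [h, ← S.π_coeff, ← h2, mul_assoc, S.t_mul_star_t, ← map_mul]
  rfl

/-- `π` reflects positivity: compressing by the root `k` of the negative part of `g` turns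
`π(g) ≥ 0` into `-π(k⁴) ≥ 0`. -/
theorem nonneg_of_π_nonneg [PartialOrder O] [StarOrderedRing O] {g : C(X, ℂ)} (h : 0 ≤ S.π g)
    (x : X) : 0 ≤ g x := by
  have hg : star g = g := S.π_injective (by rw [map_star]; exact (IsSelfAdjoint.of_nonneg h).star_eq)
  have hgr (y : X) : (((g y).re : ℝ) : ℂ) = g y := by
    have := DFunLike.congr_fun hg y
    exact Complex.conj_eq_iff_re.1 this
  -- `k` is the square root of the negative part of `g`
  let k : C(X, ℂ) := ⟨fun y => ((√(max (-(g y).re) 0) : ℝ) : ℂ), by fun_prop⟩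
  have hk : star k = k := by ext y; exact Complex.conj_ofReal _
  have hkk (y : X) : (k * k) y = ((max (-(g y).re) 0 : ℝ) : ℂ) := by
    change ((√(max (-(g y).re) 0) : ℝ) : ℂ) * ((√(max (-(g y).re) 0) : ℝ) : ℂ) = _
    rw [← Complex.ofReal_mul, Real.mul_self_sqrt (le_max_right _ _)]
  have h1 : 0 ≤ S.π (star k * g * k) := by
    rw [map_mul, map_mul, map_star]
    exact star_left_conjugate_nonneg h _
  have h2 : star k * g * k = -(star (k * k) * (k * k)) := by
    ext y
    have e1 : (star k * g * k) y = (k * k) y * g y := by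
      rw [hk]; simp only [ContinuousMap.mul_apply]; ring
    have e2 : (-(star (k * k) * (k * k))) y = -((k * k) y * (k * k) y) := by
      rw [star_mul, hk]; rfl
    rw [e1, e2, hkk, ← hgr y]
    norm_cast
    rcases le_total 0 (g y).re with h | h
    · simp [h]
    · rw [max_eq_left (by simpa using h)]; ring
  rw [h2, map_neg, map_mul, map_star, neg_nonneg] at h1
  have h3 := le_antisymm h1 (star_mul_self_nonneg _)
  rw [CStarRing.star_mul_self_eq_zero_iff] at h3
  have h4 : k * k = 0 := S.π_injective (by rw [h3, map_zero])
  have h5 := hkk x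
  rw [h4] at h5
  have h6 : max (-(g x).re) 0 = 0 := Complex.ofReal_eq_zero.1 h5.symm
  rw [← hgr x]
  exact_mod_cast neg_nonpos.1 (max_eq_right_iff.1 h6)

theorem coeff_star_mul_self_nonneg (a : O) (x : X) : 0 ≤ S.coeff (star a * a) x := by
  let _ := CStarAlgebra.spectralOrder O
  have _ := CStarAlgebra.spectralOrderedRing O
  refine S.nonneg_of_π_nonneg ?_ x
  rw [S.π_coeff, expect, intervalIntegral.integral_of_le zero_le_one]
  refine integral_nonneg fun s => ?_
  simp only [map_mul, map_star]
  exact star_mul_self_nonneg _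

end GaugeSystem

/-! ### Representing positive functionals and invariant measures -/

section Riesz

variable {X : Type u} [MetricSpace X] [CompactSpace X] [MeasurableSpace X] [BorelSpace X]

theorem ContinuousMap.integrable_of_finite (f : C(X, ℂ)) (μ : Measure X) [IsFiniteMeasure μ] :
    Integrable f μ :=
  (BoundedContinuousFunction.mkOfCompact f).integrable μ

/-- A continuous real function as a complex one. -/
def ContinuousMap.complexOfReal (f : C(X, ℝ)) : C(X, ℂ) := ⟨fun x => (f x : ℂ), by fun_prop⟩

@[simp]
theorem ContinuousMap.complexOfReal_apply (f : C(X, ℝ)) (x : X) :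
    f.complexOfReal x = (f x : ℂ) := rfl

theorem ContinuousMap.integral_complexOfReal (f : C(X, ℝ)) (μ : Measure X) :
    ∫ x, f.complexOfReal x ∂μ = ((∫ x, f x ∂μ : ℝ) : ℂ) := integral_ofReal

/-- The Riesz representation theorem for positive functionals on the C⋆-algebra `C(X)`. -/
theorem exists_finiteMeasure_of_positive (ℓ : C(X, ℂ) →ₗ[ℂ] ℂ)
    (hℓ : ∀ f, 0 ≤ ℓ (star f * f)) :
    ∃ μ : Measure X, IsFiniteMeasure μ ∧ ∀ f, ℓ f = ∫ x, f x ∂μ := by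
  let Λ₀ : CompactlySupportedContinuousMap X ℝ →ₗ[ℝ] ℝ :=
    { toFun := fun f => (ℓ f.toContinuousMap.complexOfReal).re
      map_add' := fun f g => by
        rw [← Complex.add_re, ← map_add]
        congr 2
        ext x
        simp
      map_smul' := fun c f => by
        have : (c • f).toContinuousMap.complexOfReal = (c : ℂ) • f.toContinuousMap.complexOfReal := by
          ext x
          simp
        rw [this, map_smul]
        simp }
  let Λ : CompactlySupportedContinuousMap X ℝ →ₚ[ℝ] ℝ := PositiveLinearMap.mk₀ Λ₀ (by
    intro f hf
    let g : C(X, ℝ) := ⟨fun x => √(f x), by fun_prop⟩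
    have h : f.toContinuousMap.complexOfReal = star g.complexOfReal * g.complexOfReal := by
      ext x
      have hx : f x = √(f x) * √(f x) := (Real.mul_self_sqrt (hf x)).symm
      change ((f x : ℝ) : ℂ) = (starRingEnd ℂ) ((√(f x) : ℝ) : ℂ) * ((√(f x) : ℝ) : ℂ)
      rw [Complex.conj_ofReal, ← Complex.ofReal_mul, ← hx]
    change 0 ≤ (ℓ f.toContinuousMap.complexOfReal).re
    rw [h]
    exact (Complex.nonneg_iff.1 (hℓ _)).1)
  -- squares of real functions have real values, and every real function is a difference of squares
  have him (f : C(X, ℝ)) : (ℓ f.complexOfReal).im = 0 := by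
    let g (c : ℝ) : C(X, ℂ) := ContinuousMap.complexOfReal ((1 / 2 : ℝ) • (f + ContinuousMap.const X c))
    have hg (c : ℝ) : star (g c) = g c := by
      ext x
      exact Complex.conj_ofReal _
    have h : f.complexOfReal = star (g 1) * g 1 - star (g (-1)) * g (-1) := by
      rw [hg, hg]
      ext x
      simp only [g, ContinuousMap.sub_apply, ContinuousMap.mul_apply,
        ContinuousMap.complexOfReal_apply, ContinuousMap.smul_apply, ContinuousMap.add_apply,
        ContinuousMap.const_apply, smul_eq_mul]
      push_cast
      ring
    rw [h, map_sub, Complex.sub_im, ← (Complex.nonneg_iff.1 (hℓ _)).2,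
      ← (Complex.nonneg_iff.1 (hℓ _)).2, sub_zero]
  let μ := RealRMK.rieszMeasure Λ
  have hfin : IsFiniteMeasure μ := inferInstance
  have hreal (f : C(X, ℝ)) : ℓ f.complexOfReal = ∫ x, f.complexOfReal x ∂μ := by
    have h := RealRMK.integral_rieszMeasure Λ
      ⟨f, HasCompactSupport.of_compactSpace f⟩
    rw [f.integral_complexOfReal]
    refine Complex.ext ?_ ?_
    · rw [Complex.ofReal_re]; exact h.symm
    · rw [him, Complex.ofReal_im]
  refine ⟨μ, hfin, fun f => ?_⟩
  let fr : C(X, ℝ) := ⟨fun x => (f x).re, by fun_prop⟩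
  let fi : C(X, ℝ) := ⟨fun x => (f x).im, by fun_prop⟩
  have hf : f = fr.complexOfReal + Complex.I • fi.complexOfReal := by
    ext x
    change f x = ((f x).re : ℂ) + Complex.I * ((f x).im : ℂ)
    rw [mul_comm, Complex.re_add_im]
  rw [hf, map_add, map_smul, hreal, hreal]
  rw [← integral_smul]
  exact (integral_add (fr.complexOfReal.integrable_of_finite μ)
    ((fi.complexOfReal.integrable_of_finite μ).smul Complex.I)).symm

theorem MeasureTheory.Measure.ext_of_integral_continuousMap {μ ν : Measure X} [IsFiniteMeasure μ]
    [IsFiniteMeasure ν] (h : ∀ f : C(X, ℂ), ∫ x, f x ∂μ = ∫ x, f x ∂ν) : μ = ν := by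
  refine ext_of_forall_integral_eq_of_IsFiniteMeasure fun f => ?_
  have := h f.toContinuousMap.complexOfReal
  rw [ContinuousMap.integral_complexOfReal, ContinuousMap.integral_complexOfReal] at this
  exact Complex.ofReal_injective this

theorem MeasureTheory.ProbabilityMeasure.continuous_integral (f : C(X, ℂ)) :
    Continuous fun μ : ProbabilityMeasure X => ∫ x, f x ∂(μ : Measure X) := by
  rw [continuous_iff_continuousAt]
  intro μ
  exact (ProbabilityMeasure.tendsto_iff_forall_integral_rclike_tendsto ℂ).1 Filter.tendsto_id
    (BoundedContinuousFunction.mkOfCompact f)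

variable {α : X ≃ₜ X}

theorem integral_comp_homeomorph {μ : ProbabilityMeasure X} (hμ : μ ∈ invariantMeasures α)
    (f : C(X, ℂ)) :
    ∫ x, f (α x) ∂(μ : Measure X) = ∫ x, f x ∂(μ : Measure X) := by
  have h : (μ : Measure X).map α = μ := hμ
  conv_rhs => rw [← h]
  exact (integral_map α.continuous.aemeasurable f.continuous.aestronglyMeasurable).symm

theorem integral_comp_homeomorph_symm {μ : ProbabilityMeasure X} (hμ : μ ∈ invariantMeasures α)
    (f : C(X, ℂ)) :
    ∫ x, f (α.symm x) ∂(μ : Measure X) = ∫ x, f x ∂(μ : Measure X) := by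
  have h := integral_comp_homeomorph hμ (f.comp (α.symm : C(X, X)))
  simp only [ContinuousMap.comp_apply, ContinuousMap.coe_coe, α.symm_apply_apply] at h
  exact h.symm

/-- The invariant measures form a convex set. -/
theorem exists_invariantMeasure_combination (μ ν : invariantMeasures α) (a b : ℝ≥0)
    (hab : a + b = 1) :
    ∃ ρ : invariantMeasures α, (ρ.1 : Measure X) = a • (μ.1 : Measure X) + b • (ν.1 : Measure X) := by
  have hμ : (μ.1 : Measure X).map α = μ.1 := μ.2
  have hν : (ν.1 : Measure X).map α = ν.1 := ν.2
  let ρ : Measure X := a • (μ.1 : Measure X) + b • (ν.1 : Measure X)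
  have hρ : IsProbabilityMeasure ρ := ⟨by
    have h : ρ Set.univ = (a : ℝ≥0∞) * (μ.1 : Measure X) Set.univ +
      (b : ℝ≥0∞) * (ν.1 : Measure X) Set.univ := rfl
    rw [h, measure_univ, measure_univ, mul_one, mul_one]
    exact_mod_cast hab⟩
  refine ⟨⟨⟨ρ, hρ⟩, ?_⟩, rfl⟩
  change ρ.map α = ρ
  simp only [ρ]
  rw [Measure.map_add _ _ α.continuous.measurable, Measure.map_smul, Measure.map_smul, hμ, hν]

end Riesz

/-! ### Affine maps -/

section Affine

variable {S T R P Q N : Type*} [AddCommMonoid P] [Module ℝ≥0 P] [AddCommMonoid Q] [Module ℝ≥0 Q]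
  [AddCommMonoid N] [Module ℝ≥0 N]

theorem IsAffineVia.symm {f : S ≃ T} {i : S → P} {j : T → Q} (h : IsAffineVia f i j) :
    IsAffineVia f.symm j i := by
  intro x y a b hab
  obtain ⟨z, hz1, hz2⟩ := h (f.symm x) (f.symm y) a b hab
  refine ⟨f z, ?_, ?_⟩
  · simpa using hz2
  · simpa using hz1

theorem IsAffineVia.comp {f : S → T} {g : T → R} {i : S → P} {j : T → Q} {k : R → N}
    (hj : Function.Injective j) (hg : IsAffineVia g j k) (hf : IsAffineVia f i j) :
    IsAffineVia (g ∘ f) i k := by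
  intro x y a b hab
  obtain ⟨z, hz1, hz2⟩ := hf x y a b hab
  obtain ⟨w, hw1, hw2⟩ := hg (f x) (f y) a b hab
  obtain rfl : f z = w := hj (hz2.trans hw1.symm)
  exact ⟨z, hz1, hw2⟩

end Affine

/-! ### Tracial states of a gauge system -/

namespace GaugeSystem

variable {X : Type u} [MetricSpace X] [CompactSpace X] {α : X ≃ₜ X}
  {O : Type v} [NonUnitalCStarAlgebra O] (S : GaugeSystem.{u, v, w} α O)

/-- Since `π(f) b = b π(f ∘ αⁿ)`, the functional `f ↦ τ(b π(f))` annihilates the ideal generated by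
all `f - f ∘ αⁿ`; this ideal has no common zero because `αⁿ` has no fixed point. -/
theorem trace_eq_zero_of_mem_homogeneous (hα : ∀ (n : ℤ) (x : X), n ≠ 0 → (α ^ n) x ≠ x)
    {τ : WeakDual ℂ O} (hτ : ∀ a b : O, τ (a * b) = τ (b * a)) {n : ℤ} (hn : n ≠ 0) {b : O}
    (hb : b ∈ S.homogeneous n) : τ b = 0 := by
  let J : Ideal C(X, ℂ) :=
    { carrier := {g | ∀ h, τ (b * S.π (h * g)) = 0}
      add_mem' := fun {f g} hf hg h => by
        rw [mul_add, map_add, mul_add, map_add, hf, hg, add_zero]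
      zero_mem' := fun h => by simp
      smul_mem' := fun k g hg h => by
        rw [smul_eq_mul, ← mul_assoc]
        exact hg _ }
  have hJ (f : C(X, ℂ)) : f - f.comp ((α ^ n : X ≃ₜ X) : C(X, X)) ∈ J := by
    intro h
    have h1 := hτ (S.π f) (b * S.π h)
    rw [← mul_assoc, hb.2.2 f, mul_assoc, mul_assoc, ← map_mul, ← map_mul] at h1
    rw [mul_sub, map_sub, mul_sub, map_sub, ← h1, mul_comm h, sub_self]
  have htop : J = ⊤ := by
    by_contra hne
    obtain ⟨M, hM, hJM⟩ := Ideal.exists_le_maximal J hne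
    obtain ⟨x, hx⟩ := ContinuousMap.setOfIdeal_eq_compl_singleton M
    let f : C(X, ℂ) := ⟨fun y => ((dist y x : ℝ) : ℂ), by fun_prop⟩
    have hmem : x ∈ ContinuousMap.setOfIdeal M := by
      refine ContinuousMap.mem_setOfIdeal.2 ⟨_, hJM (hJ f), ?_⟩
      change ((dist x x : ℝ) : ℂ) - ((dist ((α ^ n) x) x : ℝ) : ℂ) ≠ 0
      simpa using hα n x hn
    rw [hx] at hmem
    exact hmem rfl
  have h1 : (1 : C(X, ℂ)) ∈ J := htop ▸ Submodule.mem_top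
  simpa [S.mul_π_one] using h1 1

theorem trace_eq_trace_expect (hα : ∀ (n : ℤ) (x : X), n ≠ 0 → (α ^ n) x ≠ x)
    {τ : WeakDual ℂ O} (hτ : ∀ a b : O, τ (a * b) = τ (b * a)) (a : O) :
    τ a = τ (S.expect a) := by
  let T : O →L[ℂ] ℂ := WeakDual.toStrongDual τ - (WeakDual.toStrongDual τ).comp S.expectCLM
  have hT (b : O) : T b = τ b - τ (S.expect b) := rfl
  have h := S.mem_of_homogeneous_le (W := LinearMap.ker (T : O →ₗ[ℂ] ℂ)) T.isClosed_ker
    (fun n b hb => by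
      change T b = 0
      rw [hT]
      rcases eq_or_ne n 0 with rfl | hn
      · rw [S.expect_of_fixed fun z => by simpa using hb.2.1 z, sub_self]
      · rw [S.expect_of_mem_homogeneous hn hb, S.trace_eq_zero_of_mem_homogeneous hα hτ hn hb,
          map_zero, sub_zero]) a
  exact sub_eq_zero.1 h

variable [MeasurableSpace X] [BorelSpace X]

theorem norm_integral_coeff_le (μ : ProbabilityMeasure X) (a : O) :
    ‖∫ x, S.coeff a x ∂(μ : Measure X)‖ ≤ ‖a‖ := by
  have h := norm_integral_le_of_norm_le_const (μ := (μ : Measure X)) (C := ‖a‖)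
    (f := S.coeff a) (Filter.Eventually.of_forall fun x =>
      ((S.coeff a).norm_coe_le_norm x).trans (S.norm_coeff_le a))
  simpa using h

/-- The functional `a ↦ ∫ π⁻¹(Φ(a)) dμ`. -/
def traceOf (μ : ProbabilityMeasure X) : WeakDual ℂ O :=
  StrongDual.toWeakDual (LinearMap.mkContinuous
    { toFun := fun a => ∫ x, S.coeff a x ∂(μ : Measure X)
      map_add' := fun a b => by
        rw [S.coeff_add]
        exact integral_add ((S.coeff a).integrable_of_finite _) ((S.coeff b).integrable_of_finite _)
      map_smul' := fun c a => by
        rw [S.coeff_smul]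
        exact integral_smul c _ } 1 fun a => by
      rw [one_mul]
      exact S.norm_integral_coeff_le μ a)

theorem traceOf_apply (μ : ProbabilityMeasure X) (a : O) :
    S.traceOf μ a = ∫ x, S.coeff a x ∂(μ : Measure X) := rfl

theorem traceOf_π (μ : ProbabilityMeasure X) (f : C(X, ℂ)) :
    S.traceOf μ (S.π f) = ∫ x, f x ∂(μ : Measure X) := by
  rw [traceOf_apply, coeff_π]

theorem traceOf_star (μ : ProbabilityMeasure X) (a : O) :
    S.traceOf μ (star a) = star (S.traceOf μ a) := by
  rw [traceOf_apply, traceOf_apply, coeff_star]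
  exact integral_conj

theorem traceOf_π_mul (μ : ProbabilityMeasure X) (f : C(X, ℂ)) (a : O) :
    S.traceOf μ (S.π f * a) = S.traceOf μ (a * S.π f) := by
  rw [traceOf_apply, traceOf_apply, coeff_π_mul, coeff_mul_π, mul_comm]

theorem traceOf_t_mul_mul_star_t {μ : ProbabilityMeasure X} (hμ : μ ∈ invariantMeasures α)
    (ξ η : S.ι) (a : O) :
    S.traceOf μ (S.t ξ * a * star (S.t η)) = S.traceOf μ (star (S.t η) * S.t ξ * a) := by
  rw [traceOf_apply, traceOf_apply, coeff_t_mul_mul_star_t, S.star_t_mul_t, coeff_π_mul, mul_comm]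
  exact integral_comp_homeomorph_symm hμ (S.ip η ξ * S.coeff a)

/-- Inserting the frame on the right of `a` reduces the trace property for `t(ξ)` to the
invariance of `μ` and to the trace property for functions. -/
theorem traceOf_t_mul {μ : ProbabilityMeasure X} (hμ : μ ∈ invariantMeasures α) (ξ : S.ι) (a : O) :
    S.traceOf μ (S.t ξ * a) = S.traceOf μ (a * S.t ξ) := by
  have h1 : S.t ξ * a =
      ∑ i, S.t ξ * (a * S.t (S.frame i)) * star (S.t (S.frame i)) := by
    simp only [mul_assoc]
    rw [← Finset.mul_sum, ← Finset.mul_sum, S.sum_frame_mul_star, S.mul_π_one]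
  have h2 : a * S.t ξ =
      ∑ i, a * S.t (S.frame i) * (star (S.t (S.frame i)) * S.t ξ) := by
    simp only [mul_assoc]
    rw [← Finset.mul_sum]
    simp only [← mul_assoc]
    rw [← Finset.sum_mul, S.sum_frame_mul_star, S.π_one_mul]
  rw [h1, h2, map_sum, map_sum]
  refine Finset.sum_congr rfl fun i _ => ?_
  rw [S.traceOf_t_mul_mul_star_t hμ, S.star_t_mul_t, S.traceOf_π_mul]

theorem traceOf_mul_comm {μ : ProbabilityMeasure X} (hμ : μ ∈ invariantMeasures α) (a b : O) :
    S.traceOf μ (a * b) = S.traceOf μ (b * a) := by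
  induction a using S.induction generalizing b with
  | hp =>
    simp only [Set.ofPred_forall]
    refine isClosed_iInter fun b => isClosed_eq ?_ ?_
    · exact (WeakDual.toStrongDual (S.traceOf μ)).continuous.comp (continuous_mul_const b)
    · exact (WeakDual.toStrongDual (S.traceOf μ)).continuous.comp (continuous_const_mul b)
  | hπ f => exact S.traceOf_π_mul μ f b
  | ht ξ => exact S.traceOf_t_mul hμ ξ b
  | ht' ξ =>
    have h := congrArg star (S.traceOf_t_mul hμ ξ (star b))
    rw [← traceOf_star, ← traceOf_star, star_mul, star_mul, star_star] at h
    exact h.symm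
  | h0 => simp
  | hadd a c ha hc => rw [add_mul, mul_add, map_add, map_add, ha, hc]
  | hsmul z a ha => rw [smul_mul_assoc, mul_smul_comm, map_smul, map_smul, ha]
  | hmul a c ha hc => rw [mul_assoc, ha, mul_assoc, hc, mul_assoc]

theorem traceOf_mem_tracialStates [Nonempty X] {μ : ProbabilityMeasure X}
    (hμ : μ ∈ invariantMeasures α) : S.traceOf μ ∈ tracialStates O := by
  refine ⟨fun a => ?_, le_antisymm ?_ ?_, S.traceOf_mul_comm hμ⟩
  · exact integral_nonneg (S.coeff_star_mul_self_nonneg a)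
  · refine ContinuousLinearMap.opNorm_le_bound _ zero_le_one fun a => ?_
    rw [one_mul]
    exact S.norm_integral_coeff_le μ a
  · have h := (WeakDual.toStrongDual (S.traceOf μ)).le_opNorm (S.π 1)
    rw [WeakDual.toStrongDual_apply, S.norm_π, S.traceOf_π] at h
    simpa using h

/-- A tracial state restricts to an invariant probability measure: invariance follows by moving one
leg of the frame around the trace. -/
theorem exists_invariantMeasure [Nonempty X] (hα : ∀ (n : ℤ) (x : X), n ≠ 0 → (α ^ n) x ≠ x)
    {τ : WeakDual ℂ O} (hτ : τ ∈ tracialStates O) :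
    ∃ μ ∈ invariantMeasures α, τ = S.traceOf μ := by
  obtain ⟨hpos, hnorm, htr⟩ := hτ
  obtain ⟨μ, hμ, hint⟩ := exists_finiteMeasure_of_positive
    ((WeakDual.toStrongDual τ : O →ₗ[ℂ] ℂ) ∘ₗ (S.π : C(X, ℂ) →ₗ[ℂ] O)) (fun f => by
      change 0 ≤ τ (S.π (star f * f))
      rw [map_mul, map_star]
      exact hpos _)
  replace hint (f : C(X, ℂ)) : τ (S.π f) = ∫ x, f x ∂μ := hint f
  have hval (a : O) : τ a = ∫ x, S.coeff a x ∂μ := by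
    rw [S.trace_eq_trace_expect hα htr, ← S.π_coeff, hint]
  have hbound (a : O) : ‖τ a‖ ≤ μ.real Set.univ * ‖a‖ := by
    rw [hval, mul_comm]
    exact norm_integral_le_of_norm_le_const (Filter.Eventually.of_forall fun x =>
      ((S.coeff a).norm_coe_le_norm x).trans (S.norm_coeff_le a))
  have h1 : τ (S.π 1) = (μ.real Set.univ : ℂ) := by
    rw [hint]
    simp
  -- `τ` is integration of `coeff`, so its norm is the total mass of `μ`
  have hmass : μ.real Set.univ = 1 := by
    refine le_antisymm ?_ ?_
    · have h := (WeakDual.toStrongDual τ).le_opNorm (S.π 1)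
      rw [WeakDual.toStrongDual_apply, S.norm_π, h1, hnorm] at h
      simpa [abs_of_nonneg measureReal_nonneg] using h
    · rw [← hnorm]
      exact ContinuousLinearMap.opNorm_le_bound _ measureReal_nonneg hbound
  have hprob : IsProbabilityMeasure μ := ⟨by
    rw [measureReal_def, ENNReal.toReal_eq_one_iff] at hmass
    exact hmass⟩
  have hinv : μ.map α = μ := by
    have : IsFiniteMeasure (μ.map α) := inferInstance
    refine Measure.ext_of_integral_continuousMap fun f => ?_
    rw [integral_map α.continuous.aemeasurable f.continuous.aestronglyMeasurable]
    -- the two sums differ by a cyclic permutation of their factors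
    have e1 : S.π f = ∑ i, S.π f * S.t (S.frame i) * star (S.t (S.frame i)) := by
      simp only [mul_assoc]
      rw [← Finset.mul_sum, S.sum_frame_mul_star, S.mul_π_one]
    have e2 : S.π (f.comp (α : C(X, X))) =
        ∑ i, star (S.t (S.frame i)) * (S.π f * S.t (S.frame i)) := by
      simp only [S.π_mul_t, ← mul_assoc]
      rw [← Finset.sum_mul, S.sum_star_frame_mul, S.π_one_mul]
    have e3 : τ (S.π f) = τ (S.π (f.comp (α : C(X, X)))) := by
      rw [e1, e2, map_sum, map_sum]
      exact Finset.sum_congr rfl fun i _ => htr _ _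
    rw [hint, hint] at e3
    exact e3.symm
  refine ⟨⟨μ, hprob⟩, hinv, ?_⟩
  exact DFunLike.ext _ _ hval

theorem traceOf_injective : Function.Injective S.traceOf := by
  intro μ ν h
  have hμν : (μ : Measure X) = ν := Measure.ext_of_integral_continuousMap fun f => by
    have := DFunLike.congr_fun h (S.π f)
    rwa [traceOf_π, traceOf_π] at this
  exact Subtype.ext hμν

theorem continuous_traceOf : Continuous S.traceOf :=
  WeakDual.continuous_of_continuous_eval fun a =>
    ProbabilityMeasure.continuous_integral (S.coeff a)

variable [Nonempty X] (hα : ∀ (n : ℤ) (x : X), n ≠ 0 → (α ^ n) x ≠ x)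

/-- The bijection between invariant measures and tracial states. -/
def tracialEquiv : invariantMeasures α ≃ tracialStates O :=
  Equiv.ofBijective (fun μ => ⟨S.traceOf μ, S.traceOf_mem_tracialStates μ.2⟩)
    ⟨fun _ _ h => Subtype.ext (S.traceOf_injective (congrArg Subtype.val h)), fun τ => by
      obtain ⟨μ, hμ, h⟩ := S.exists_invariantMeasure hα τ.2
      exact ⟨⟨μ, hμ⟩, Subtype.ext h.symm⟩⟩

theorem coe_tracialEquiv (μ : invariantMeasures α) :
    (S.tracialEquiv hα μ : WeakDual ℂ O) = S.traceOf μ := rfl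

theorem apply_π_eq_integral (τ : tracialStates O) (f : C(X, ℂ)) :
    (τ : WeakDual ℂ O) (S.π f) =
      ∫ x, f x ∂(((S.tracialEquiv hα).symm τ : ProbabilityMeasure X) : Measure X) := by
  obtain ⟨μ, rfl⟩ := (S.tracialEquiv hα).surjective τ
  rw [Equiv.symm_apply_apply, coe_tracialEquiv, traceOf_π]

/-- Tracial states are homeomorphic to invariant measures. -/
def tracialHomeomorph : tracialStates O ≃ₜ invariantMeasures α where
  toEquiv := (S.tracialEquiv hα).symm
  continuous_toFun := by
    refine Continuous.subtype_mk (f := fun τ => ((S.tracialEquiv hα).symm τ).1) ?_ _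
    rw [ProbabilityMeasure.continuous_iff_forall_continuousMap_continuous_integral]
    intro f
    have h (τ : tracialStates O) : ∫ x, f x ∂(((S.tracialEquiv hα).symm τ : ProbabilityMeasure X) :
        Measure X) = ((τ : WeakDual ℂ O) (S.π f.complexOfReal)).re := by
      rw [S.apply_π_eq_integral hα, ContinuousMap.integral_complexOfReal, Complex.ofReal_re]
    simp only [h]
    exact Complex.continuous_re.comp
      ((WeakDual.eval_continuous (S.π f.complexOfReal)).comp continuous_subtype_val)
  continuous_invFun := (S.continuous_traceOf.comp continuous_subtype_val).subtype_mk _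

theorem isAffineVia_tracialEquiv :
    IsAffineVia (S.tracialEquiv hα) (fun μ => (μ.1 : Measure X)) (fun τ => τ.1) := by
  intro μ ν a b hab
  obtain ⟨ρ, hρ⟩ := exists_invariantMeasure_combination μ ν a b hab
  refine ⟨ρ, hρ, ?_⟩
  refine DFunLike.ext _ _ fun c => ?_
  change S.traceOf ρ c = a • S.traceOf μ c + b • S.traceOf ν c
  simp only [traceOf_apply]
  rw [hρ, integral_add_measure, integral_smul_nnreal_measure, integral_smul_nnreal_measure]
  · exact ((S.coeff c).integrable_of_finite _).smul_measure_nnreal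
  · exact ((S.coeff c).integrable_of_finite _).smul_measure_nnreal

theorem isAffineVia_tracialHomeomorph :
    IsAffineVia (S.tracialHomeomorph hα) (fun τ => τ.1) (fun μ => (μ.1 : Measure X)) :=
  (S.isAffineVia_tracialEquiv hα).symm

end GaugeSystem

/-! ### Diagonal operators and permutations on `ℓ²` -/

section EllTwo

variable {ι : Type w}

/-- A bounded function as an element of `ℓ^∞`. -/
def boundedFun (g : ι → ℂ) (hg : ∃ C, ∀ i, ‖g i‖ ≤ C) : lp (fun _ : ι => ℂ) ∞ :=
  ⟨g, memℓp_infty ⟨hg.choose, by rintro _ ⟨i, rfl⟩; exact hg.choose_spec i⟩⟩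

@[simp]
theorem boundedFun_apply (g : ι → ℂ) (hg : ∃ C, ∀ i, ‖g i‖ ≤ C) (i : ι) :
    boundedFun g hg i = g i := rfl

/-- The diagonal operator with entries `g i`. -/
def diagOp (g : lp (fun _ : ι => ℂ) ∞) : lp (fun _ : ι => ℂ) 2 →L[ℂ] lp (fun _ : ι => ℂ) 2 :=
  lp.mapCLM 2 (fun i => g i • ContinuousLinearMap.id ℂ ℂ) (norm_nonneg g) fun i => by
    rw [norm_smul, ContinuousLinearMap.norm_id, mul_one]
    exact lp.norm_apply_le_norm ENNReal.top_ne_zero g i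

@[simp]
theorem diagOp_apply (g : lp (fun _ : ι => ℂ) ∞) (h : lp (fun _ : ι => ℂ) 2) (i : ι) :
    diagOp g h i = g i * h i := by
  simp [diagOp]

theorem diagOp_star (g : lp (fun _ : ι => ℂ) ∞) : diagOp (star g) = star (diagOp g) := by
  rw [ContinuousLinearMap.star_eq_adjoint, ContinuousLinearMap.eq_adjoint_iff]
  intro x y
  rw [lp.inner_eq_tsum, lp.inner_eq_tsum]
  refine tsum_congr fun i => ?_
  simp only [diagOp_apply, lp.star_apply, RCLike.inner_apply, map_mul, RCLike.star_def,
    RCLike.conj_conj]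
  ring

theorem norm_apply_le_norm_diagOp (g : lp (fun _ : ι => ℂ) ∞) (i : ι) : ‖g i‖ ≤ ‖diagOp g‖ := by
  classical
  have h := (diagOp g).le_opNorm (lp.single 2 i (1 : ℂ))
  rw [lp.norm_single (by norm_num), norm_one, mul_one] at h
  refine le_trans ?_ ((lp.norm_apply_le_norm two_ne_zero _ i).trans h)
  simp

theorem memℓp_two_comp_equiv (σ : Equiv.Perm ι) (h : lp (fun _ : ι => ℂ) 2) :
    Memℓp (fun i => h (σ i)) 2 := by
  have h2 : 0 < (2 : ℝ≥0∞).toReal := by norm_num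
  rw [memℓp_gen_iff h2]
  exact ((memℓp_gen_iff h2).1 (lp.memℓp h)).comp_injective σ.injective

/-- The permutation operator carrying the basis vector at `i` to the one at `σ i`. -/
def permOp (σ : Equiv.Perm ι) : lp (fun _ : ι => ℂ) 2 →L[ℂ] lp (fun _ : ι => ℂ) 2 :=
  LinearMap.mkContinuous
    { toFun := fun h => ⟨fun i => h (σ.symm i), memℓp_two_comp_equiv σ.symm h⟩
      map_add' := fun _ _ => rfl
      map_smul' := fun _ _ => rfl } 1 fun h => by
    have h2 : 0 < (2 : ℝ≥0∞).toReal := by norm_num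
    rw [one_mul, lp.norm_eq_tsum_rpow h2, lp.norm_eq_tsum_rpow h2]
    exact le_of_eq (congrArg (· ^ _)
      (σ.symm.tsum_eq fun i => ‖h i‖ ^ (2 : ℝ≥0∞).toReal))

@[simp]
theorem permOp_apply (σ : Equiv.Perm ι) (h : lp (fun _ : ι => ℂ) 2) (i : ι) :
    permOp σ h i = h (σ.symm i) := rfl

theorem permOp_star (σ : Equiv.Perm ι) : star (permOp σ) = permOp σ.symm := by
  rw [ContinuousLinearMap.star_eq_adjoint, eq_comm, ContinuousLinearMap.eq_adjoint_iff]
  intro x y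
  rw [lp.inner_eq_tsum, lp.inner_eq_tsum]
  simp only [permOp_apply, Equiv.symm_symm]
  rw [← σ.tsum_eq (fun i => inner ℂ (x i) (y (σ.symm i)))]
  simp

theorem star_permOp_mul_permOp (σ : Equiv.Perm ι) : star (permOp σ) * permOp σ = 1 := by
  rw [permOp_star]
  ext h i
  simp

theorem permOp_mul_star_permOp (σ : Equiv.Perm ι) : permOp σ * star (permOp σ) = 1 := by
  rw [permOp_star]
  ext h i
  simp

/-- The permutation operator as a unitary. -/
def permUnitary (σ : Equiv.Perm ι) :
    unitary (lp (fun _ : ι => ℂ) 2 →L[ℂ] lp (fun _ : ι => ℂ) 2) :=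
  ⟨permOp σ, star_permOp_mul_permOp σ, permOp_mul_star_permOp σ⟩

theorem diagOp_mul_permOp (σ : Equiv.Perm ι) {f g : lp (fun _ : ι => ℂ) ∞}
    (hfg : ∀ i, g i = f (σ i)) : diagOp f * permOp σ = permOp σ * diagOp g := by
  ext h i
  simp [hfg]

variable {X : Type u} [TopologicalSpace X] [CompactSpace X]

/-- Multiplication operators on `ℓ²(ι)`: a function on `X` acts diagonally through `p : ι → X`. -/
def mulRep (p : ι → X) :
    C(X, ℂ) →⋆ₐ[ℂ] (lp (fun _ : ι => ℂ) 2 →L[ℂ] lp (fun _ : ι => ℂ) 2) where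
  toFun f := diagOp (boundedFun (fun i => f (p i)) ⟨‖f‖, fun i => f.norm_coe_le_norm (p i)⟩)
  map_one' := by ext h i; simp
  map_mul' f g := by ext h i; simp [mul_assoc]
  map_zero' := by ext h i; simp
  map_add' f g := by ext h i; simp [add_mul]
  commutes' c := by ext h i; simp [Algebra.algebraMap_eq_smul_one]
  map_star' f := by
    rw [← diagOp_star]
    rfl

@[simp]
theorem mulRep_apply (p : ι → X) (f : C(X, ℂ)) (h : lp (fun _ : ι => ℂ) 2) (i : ι) :
    mulRep p f h i = f (p i) * h i := by
  simp [mulRep]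

theorem norm_le_norm_mulRep {p : ι → X} (hp : Function.Surjective p) (f : C(X, ℂ)) :
    ‖f‖ ≤ ‖mulRep p f‖ := by
  refine (ContinuousMap.norm_le f (norm_nonneg _)).2 fun x => ?_
  obtain ⟨i, rfl⟩ := hp x
  exact norm_apply_le_norm_diagOp (boundedFun (fun i => f (p i))
    ⟨‖f‖, fun i => f.norm_coe_le_norm (p i)⟩) i

end EllTwo

/-! ### The crossed product as a gauge system -/

/-- A closed ⋆-subalgebra containing `s` of the C⋆-algebra generated by `s` is everything. -/
theorem NonUnitalStarAlgebra.mem_of_subset_of_isClosed {A : Type u} [NonUnitalCStarAlgebra A]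
    (s : Set A) (S : NonUnitalStarSubalgebra ℂ (NonUnitalStarAlgebra.adjoin ℂ s).topologicalClosure)
    (hS : IsClosed (S : Set (NonUnitalStarAlgebra.adjoin ℂ s).topologicalClosure))
    (hs : ∀ a ∈ s, ∃ b ∈ S, (b : A) = a)
    (a : (NonUnitalStarAlgebra.adjoin ℂ s).topologicalClosure) : a ∈ S := by
  let B := (NonUnitalStarAlgebra.adjoin ℂ s).topologicalClosure
  let T : NonUnitalStarSubalgebra ℂ A := S.map (NonUnitalStarSubalgebraClass.subtype B)
  have hT : IsClosed (T : Set A) :=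
    (NonUnitalStarSubalgebra.isClosed_topologicalClosure
      (NonUnitalStarAlgebra.adjoin ℂ s)).isClosedEmbedding_subtypeVal.isClosedMap _ hS
  have hle : NonUnitalStarAlgebra.adjoin ℂ s ≤ T := NonUnitalStarAlgebra.adjoin_le hs
  obtain ⟨b, hb, hba⟩ := NonUnitalStarSubalgebra.topologicalClosure_minimal _ hle hT a.2
  obtain rfl : b = a := Subtype.ext hba
  exact hb

section CrossedProductGauge

variable {A : Type u} [CStarAlgebra A] {β : A ≃⋆ₐ[ℂ] A}

/-- The covariant pair `(π, z U)` for `z` on the unit circle. -/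
def CovariantPair.rotate (z : Circle) (R : CovariantPair β) : CovariantPair β where
  B := R.B
  π := R.π
  U := ⟨(z : ℂ) • (R.U : R.B), by
    have hz : (starRingEnd ℂ) (z : ℂ) * z = 1 := by
      rw [← Complex.normSq_eq_conj_mul_self]; simp
    have hz' : (z : ℂ) * (starRingEnd ℂ) (z : ℂ) = 1 := by rw [mul_comm, hz]
    rw [Unitary.mem_iff]
    simp [smul_smul, hz, hz']⟩
  implements a := by
    have hz : (starRingEnd ℂ) (z : ℂ) * z = 1 := by
      rw [← Complex.normSq_eq_conj_mul_self]; simp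
    rw [← R.implements]
    simp [smul_smul, hz]

variable (β)

/-- The gauge automorphism on the ambient product: it permutes the factors by rotation. -/
def crossedAmbientGauge (z : Circle) : CrossedAmbient β →⋆ₙₐ[ℂ] CrossedAmbient β where
  toFun f := ⟨fun R => f (R.rotate z), memℓp_infty ⟨‖f‖, by
    rintro _ ⟨R, rfl⟩
    exact lp.norm_apply_le_norm ENNReal.top_ne_zero f (R.rotate z)⟩⟩
  map_smul' _ _ := rfl
  map_zero' := rfl
  map_add' _ _ := rfl
  map_mul' _ _ := rfl
  map_star' _ := rfl

theorem crossedAmbientU_mem : crossedAmbientU β ∈ crossedProduct β :=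
  NonUnitalStarSubalgebra.le_topologicalClosure _
    (NonUnitalStarAlgebra.subset_adjoin ℂ _ (Or.inr rfl))

theorem crossedAmbientGauge_mem (z : Circle) {f : CrossedAmbient β} (hf : f ∈ crossedProduct β) :
    crossedAmbientGauge β z f ∈ crossedProduct β := by
  have hcont : Continuous (crossedAmbientGauge β z) :=
    AddMonoidHomClass.continuous_of_bound (crossedAmbientGauge β z) 1 fun f => by
      rw [one_mul]
      exact NonUnitalStarAlgHom.norm_apply_le _ f
  have hle : NonUnitalStarAlgebra.adjoin ℂ (Set.range (crossedAmbientπ β) ∪ {crossedAmbientU β}) ≤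
      (crossedProduct β).comap (crossedAmbientGauge β z) := by
    refine NonUnitalStarAlgebra.adjoin_le ?_
    rintro _ (⟨a, rfl⟩ | rfl)
    · exact (crossedπ β a).2
    · exact SMulMemClass.smul_mem (z : ℂ) (crossedAmbientU_mem β)
  exact NonUnitalStarSubalgebra.topologicalClosure_minimal _ hle
    ((NonUnitalStarSubalgebra.isClosed_topologicalClosure _).preimage hcont) hf

/-- The dual action of the circle on the crossed product: it fixes `A` and multiplies the
implementing unitary by `z`. -/
def crossedGauge (z : Circle) : crossedProduct β →⋆ₙₐ[ℂ] crossedProduct β where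
  toFun a := ⟨crossedAmbientGauge β z a, crossedAmbientGauge_mem β z a.2⟩
  map_smul' _ _ := rfl
  map_zero' := rfl
  map_add' _ _ := rfl
  map_mul' _ _ := rfl
  map_star' _ := rfl

/-- The implementing unitary in the crossed product. -/
def crossedU : crossedProduct β := ⟨crossedAmbientU β, crossedAmbientU_mem β⟩

end CrossedProductGauge

section CrossedProductSystem

variable {X : Type u} [TopologicalSpace X] [CompactSpace X] (α : X ≃ₜ X)

/-- The covariant pair on `ℓ²(X)` consisting of multiplication operators and the permutation `α`. -/
def ellTwoPair : CovariantPair (α.symm.compStarAlgEquiv' ℂ ℂ) where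
  B := lp (fun _ : X => ℂ) 2 →L[ℂ] lp (fun _ : X => ℂ) 2
  π := mulRep id
  U := permUnitary α.toEquiv
  implements f := by
    change permOp α.toEquiv * mulRep id f * star (permOp α.toEquiv) = _
    rw [permOp_star]
    ext h x
    simp

theorem norm_crossedπ (f : C(X, ℂ)) : ‖crossedπ (α.symm.compStarAlgEquiv' ℂ ℂ) f‖ = ‖f‖ := by
  refine le_antisymm (NonUnitalStarAlgHom.norm_apply_le _ f) ?_
  refine (norm_le_norm_mulRep Function.surjective_id f).trans ?_
  exact lp.norm_apply_le_norm ENNReal.top_ne_zero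
    (crossedAmbientπ (α.symm.compStarAlgEquiv' ℂ ℂ) f) (ellTwoPair α)

/-- The crossed product `C(X) ⋊_α ℤ` as a gauge system with the single generator `u`. -/
def crossedSystem : GaugeSystem.{u, u + 1, 0} α (crossedProduct (α.symm.compStarAlgEquiv' ℂ ℂ)) where
  π := crossedπ _
  norm_π := norm_crossedπ α
  ι := Unit
  t _ := crossedU _
  ip _ _ := 1
  star_t_mul_t _ _ := by
    refine Subtype.ext (lp.ext (funext fun R => ?_))
    exact (Unitary.coe_star_mul_self R.U).trans (map_one R.π).symm
  t_mul_star_t _ _ := by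
    refine Subtype.ext (lp.ext (funext fun R => ?_))
    exact (Unitary.coe_mul_star_self R.U).trans (map_one R.π).symm
  π_mul_t f _ := by
    refine Subtype.ext (lp.ext (funext fun R => ?_))
    change R.π f * (R.U : R.B) = (R.U : R.B) * R.π (f.comp (α : C(X, X)))
    have h := R.implements (f.comp (α : C(X, X)))
    have hf : α.symm.compStarAlgEquiv' ℂ ℂ (f.comp (α : C(X, X))) = f := by
      ext x
      simp
    rw [hf] at h
    rw [← h, mul_assoc, Unitary.coe_star_mul_self, mul_one]
  n := 1
  frame _ := ()
  sum_ip_frame := by simp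
  generates S hS hπ ht := NonUnitalStarAlgebra.mem_of_subset_of_isClosed _ S hS (by
    rintro _ (⟨f, rfl⟩ | rfl)
    · exact ⟨_, hπ f, rfl⟩
    · exact ⟨_, ht (), rfl⟩)
  σ := crossedGauge _
  σ_π _ _ := rfl
  σ_t _ _ := rfl

end CrossedProductSystem

/-! ### Frames of sections of a Hermitian line bundle -/

section Frames

variable {X : Type u} [TopologicalSpace X] {L : X → Type v}
  [∀ x, NormedAddCommGroup (L x)] [∀ x, InnerProductSpace ℂ (L x)]
  [TopologicalSpace (Bundle.TotalSpace ℂ L)] [FiberBundle ℂ L] [VectorBundle ℂ ℂ L]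

variable (L) in
theorem finrank_fiber (x : X) : Module.finrank ℂ (L x) = 1 := by
  rw [((trivializationAt ℂ L x).continuousLinearEquivAt ℂ x
    (FiberBundle.mem_baseSet_trivializationAt' x)).toLinearEquiv.finrank_eq]
  exact Module.finrank_self ℂ

variable (L) in
theorem exists_unit_vector (x : X) : ∃ e : L x, ‖e‖ = 1 := by
  have : Nontrivial (L x) := Module.nontrivial_of_finrank_pos (R := ℂ) (by
    rw [finrank_fiber L x]; exact one_pos)
  obtain ⟨v, hv⟩ := exists_ne (0 : L x)
  exact ⟨((‖v‖⁻¹ : ℝ) : ℂ) • v, by simpa using norm_smul_inv_norm (𝕜 := ℂ) hv⟩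

/-- In a one-dimensional space the rank one operators are multiples of the identity. -/
theorem inner_smul_eq_inner_smul (x : X) (u v w : L x) :
    (inner ℂ v w : ℂ) • u = (inner ℂ v u : ℂ) • w := by
  obtain ⟨e, he⟩ := exists_unit_vector L x
  have he0 : e ≠ 0 := by
    rintro rfl
    simp at he
  obtain ⟨a, rfl⟩ := exists_smul_eq_of_finrank_eq_one (finrank_fiber L x) he0 u
  obtain ⟨b, rfl⟩ := exists_smul_eq_of_finrank_eq_one (finrank_fiber L x) he0 w
  rw [_root_.inner_smul_right, _root_.inner_smul_right, smul_smul, smul_smul]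
  congr 1
  ring

end Frames

namespace Sections

variable {X : Type u} [MetricSpace X] {L : X → Type v}
  [∀ x, NormedAddCommGroup (L x)] [∀ x, InnerProductSpace ℂ (L x)]
  [TopologicalSpace (Bundle.TotalSpace ℂ L)] [FiberBundle ℂ L] [VectorBundle ℂ ℂ L]

/-- Cut off a local frame by a function supported in a closed ball inside the domain of a
trivialization. -/
theorem exists_apply_ne_zero (x₀ : X) : ∃ s : Sections L, s x₀ ≠ 0 := by
  let e := trivializationAt ℂ L x₀
  have hx₀ : x₀ ∈ e.baseSet := FiberBundle.mem_baseSet_trivializationAt' x₀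
  obtain ⟨r, hr, hball⟩ := Metric.nhds_basis_closedBall.mem_iff.1 (e.open_baseSet.mem_nhds hx₀)
  let χ : X → ℂ := fun x => ((max (r - dist x x₀) 0 : ℝ) : ℂ)
  have hχ : Continuous χ := by fun_prop
  have hχ0 (x : X) (hx : r ≤ dist x x₀) : χ x = 0 := by
    simp [χ, hx]
  let s : ∀ x, L x := fun x => χ x • e.symm x (1 : ℂ)
  have hs : IsContSection s := by
    rw [isContSection_iff]
    intro x₁
    let e₁ := trivializationAt ℂ L x₁
    by_cases hx₁ : x₁ ∈ e.baseSet
    · have h1 : ContinuousOn (fun x => (⟨x, e.symm x 1⟩ : Bundle.TotalSpace ℂ L)) e.baseSet :=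
        e.continuousOn_symm.comp (f := fun x => (x, (1 : ℂ))) (by fun_prop)
          (fun x hx => by simpa using hx) |>.congr fun x hx => rfl
      have h2 := h1.continuousAt (e.open_baseSet.mem_nhds hx₁)
      have h3 : ContinuousAt (fun x => e₁.linearMapAt ℂ x (e.symm x 1)) x₁ := by
        rw [FiberBundle.continuousAt_totalSpace] at h2
        refine h2.2.congr ?_
        filter_upwards [e₁.open_baseSet.mem_nhds (FiberBundle.mem_baseSet_trivializationAt' x₁)]
          with x hx
        rw [Bundle.Trivialization.coe_linearMapAt_of_mem _ hx]
      simp only [s, map_smul]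
      exact hχ.continuousAt.smul h3
    · have hfar : r < dist x₁ x₀ := by
        by_contra h
        exact hx₁ (hball (not_lt.1 h))
      have h1 : ∀ᶠ x in 𝓝 x₁, r < dist x x₀ :=
        (by fun_prop : Continuous fun x => dist x x₀).continuousAt.eventually (lt_mem_nhds hfar)
      refine (continuousAt_const (y := (0 : ℂ))).congr ?_
      filter_upwards [h1] with x hx
      simp [s, hχ0 x hx.le]
  refine ⟨⟨s, hs⟩, ?_⟩
  change χ x₀ • e.symm x₀ (1 : ℂ) ≠ 0
  refine smul_ne_zero ?_ fun h => ?_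
  · simpa [χ] using hr
  · have := e.linearMapAt_symm (R := ℂ) hx₀ (1 : ℂ)
    rw [h] at this
    simp at this

variable [CompactSpace X] [IsHermitianLineBundle L]

variable (L) in
/-- Finitely many sections have no common zero; dividing them by the root of the sum of their
squared norms gives a frame. -/
theorem exists_frame : ∃ (n : ℕ) (ξ : Fin n → Sections L),
    ∑ i, (inner C(X, ℂ) (ξ i) (ξ i) : C(X, ℂ)) = 1 := by
  choose s hs using fun x₀ : X => exists_apply_ne_zero (L := L) x₀
  have hU (x₀ : X) : {x | s x₀ x ≠ 0} ∈ 𝓝 x₀ := by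
    have h : {x | s x₀ x ≠ 0} = {x | ‖s x₀ x‖ ≠ 0} := by ext x; simp
    rw [h]
    exact (isOpen_ne_fun (s x₀).continuous_norm continuous_const).mem_nhds
      (norm_ne_zero_iff.2 (hs x₀))
  obtain ⟨F, hF⟩ := CompactSpace.elim_nhds_subcover _ hU
  let g : X → ℝ := fun x => ∑ y ∈ F, ‖s y x‖ ^ 2
  have hg : Continuous g := continuous_finsetSum _ fun y _ => (s y).continuous_norm.pow 2
  have hgpos (x : X) : 0 < g x := by
    have hx : x ∈ ⋃ y ∈ F, {x | s y x ≠ 0} := by rw [hF]; trivial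
    simp only [Set.mem_iUnion] at hx
    obtain ⟨y, hy, hxy⟩ := hx
    have hxy' : s y x ≠ 0 := hxy
    exact Finset.sum_pos' (fun _ _ => by positivity) ⟨y, hy, by positivity⟩
  let k : C(X, ℂ) := ⟨fun x => (((√(g x))⁻¹ : ℝ) : ℂ), Complex.continuous_ofReal.comp
    ((Real.continuous_sqrt.comp hg).inv₀ fun x => (Real.sqrt_pos.2 (hgpos x)).ne')⟩
  refine ⟨F.card, fun i => k • s (F.equivFin.symm i), ?_⟩
  ext x
  rw [ContinuousMap.sum_apply]
  have h1 (y : X) : (inner C(X, ℂ) (k • s y) (k • s y) : C(X, ℂ)) x =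
      (((g x)⁻¹ * ‖s y x‖ ^ 2 : ℝ) : ℂ) := by
    rw [inner_apply, fun_smul_apply, _root_.inner_smul_left, _root_.inner_smul_right,
      inner_self_eq_norm_sq_to_K]
    change (starRingEnd ℂ) (((√(g x))⁻¹ : ℝ) : ℂ) *
      ((((√(g x))⁻¹ : ℝ) : ℂ) * ((‖s y x‖ : ℝ) : ℂ) ^ 2) = _
    rw [Complex.conj_ofReal]
    have h2 : (g x)⁻¹ = (√(g x))⁻¹ * (√(g x))⁻¹ := by
      rw [← mul_inv, Real.mul_self_sqrt (hgpos x).le]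
    rw [h2]
    push_cast
    ring
  simp only [h1]
  rw [← Complex.ofReal_sum, ← Finset.mul_sum,
    Equiv.sum_comp F.equivFin.symm (fun y : F => ‖s y x‖ ^ 2),
    Finset.sum_coe_sort F (fun y => ‖s y x‖ ^ 2), inv_mul_cancel₀ (hgpos x).ne']
  simp

end Sections

/-! ### The Cuntz–Pimsner algebra as a gauge system -/

section CuntzPimsner

variable {X : Type u} [MetricSpace X] [CompactSpace X] (L : X → Type v)
  [∀ x, NormedAddCommGroup (L x)] [∀ x, InnerProductSpace ℂ (L x)]
  [TopologicalSpace (Bundle.TotalSpace ℂ L)] [FiberBundle ℂ L] [VectorBundle ℂ ℂ L]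
  [IsHermitianLineBundle L] (α : X ≃ₜ X)

variable {L} in
/-- A rank one operator on `Γ(L)` is the left action of a function. -/
theorem φ_eq_rankOneOp (ξ η : Sections L) :
    (sectionCorrespondence L α).φ ((inner C(X, ℂ) η ξ : C(X, ℂ)).comp (α.symm : C(X, X))) =
      rankOneOp C(X, ℂ) ξ η := by
  ext ζ x
  rw [sectionCorrespondence_apply]
  change (inner C(X, ℂ) η ξ : C(X, ℂ)) (α.symm (α x)) • ζ x = (inner ℂ (η x) (ζ x) : ℂ) • ξ x
  rw [α.symm_apply_apply, Sections.inner_apply]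
  exact inner_smul_eq_inner_smul x _ _ _

theorem eq_zero_of_φ_eq_zero {f : C(X, ℂ)} (hf : (sectionCorrespondence L α).φ f = 0) : f = 0 := by
  ext x
  obtain ⟨s, hs⟩ := Sections.exists_apply_ne_zero (L := L) (α.symm x)
  have h : ((sectionCorrespondence L α).φ f s) (α.symm x) = 0 := by
    rw [hf]
    rfl
  rw [sectionCorrespondence_apply, α.apply_symm_apply] at h
  exact (smul_eq_zero.1 h).resolve_right hs

variable {L} in
/-- Since the left action is faithful, covariance applies to every function acting by a rank one
operator. -/
theorem covariantRep_t_mul_star_t (R : (sectionCorrespondence L α).CovariantRep)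
    (ξ η : Sections L) :
    R.t ξ * star (R.t η) = R.π ((inner C(X, ℂ) η ξ : C(X, ℂ)).comp (α.symm : C(X, X))) := by
  obtain ⟨ψ, h1, h2⟩ := R.covariant
  have hmem : (inner C(X, ℂ) η ξ : C(X, ℂ)).comp (α.symm : C(X, X)) ∈
      (sectionCorrespondence L α).katsuraIdeal :=
    ⟨by rw [φ_eq_rankOneOp]; exact rankOneOp_mem ξ η, fun b hb => by
      rw [eq_zero_of_φ_eq_zero L α hb, mul_zero]⟩
  rw [h2 _ hmem, ← h1]
  congr 2
  exact (φ_eq_rankOneOp α ξ η).symm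

/-- The right action is implemented by `π`, by the C⋆-identity applied to the difference. -/
theorem covariantRep_t_smul {A : Type u} [CommCStarAlgebra A] [PartialOrder A] [StarOrderedRing A]
    {E : Type v} [NormedAddCommGroup E] [NormedSpace ℂ E] [CompleteSpace E] [Module A E]
    [CStarModule A E] {C : CStarCorrespondence A E} (R : C.CovariantRep) (a : A) (ξ : E) :
    R.t (a • ξ) = R.t ξ * R.π a := by
  rw [← sub_eq_zero, ← CStarRing.star_mul_self_eq_zero_iff]
  simp only [star_sub, star_mul, mul_sub, sub_mul]
  rw [← R.map_inner, ← mul_assoc (star (R.t (a • ξ))), ← R.map_inner, mul_assoc (star (R.π a)),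
    ← R.map_inner, ← mul_assoc (star (R.π a) * star (R.t ξ)), mul_assoc (star (R.π a)) (star (R.t ξ)),
    ← R.map_inner, ← map_star]
  simp only [← map_mul, ← map_sub]
  rw [CStarModule.inner_op_smul_left, CStarModule.inner_op_smul_right,
    CStarModule.inner_op_smul_left]
  convert map_zero R.π
  ring

/-- A unit vector in every fibre; no continuity is required. -/
def unitVector (x : X) : L x := (exists_unit_vector L x).choose

theorem norm_unitVector (x : X) : ‖unitVector L x‖ = 1 := (exists_unit_vector L x).choose_spec

/-- The permutation of the index set of `ℓ²(X)` given by `α`; the lift places the Hilbert space in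
the universe of the covariant representations. -/
def liftPerm : Equiv.Perm (ULift.{v, u} X) := Equiv.ulift.trans (α.toEquiv.trans Equiv.ulift.symm)

variable {L} in
/-- The coordinates of a section with respect to `unitVector`, as a diagonal operator. -/
def coordOp (ξ : Sections L) :
    lp (fun _ : ULift.{v, u} X => ℂ) 2 →L[ℂ] lp (fun _ : ULift.{v, u} X => ℂ) 2 :=
  diagOp (boundedFun (fun i => inner ℂ (unitVector L i.down) (ξ i.down)) ⟨‖ξ‖, fun i => by
    refine (norm_inner_le_norm _ _).trans ?_
    rw [norm_unitVector, one_mul]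
    exact ξ.norm_apply_le _⟩)

variable {L} in
@[simp]
theorem coordOp_apply (ξ : Sections L) (h : lp (fun _ : ULift.{v, u} X => ℂ) 2)
    (i : ULift.{v, u} X) :
    coordOp ξ h i = inner ℂ (unitVector L i.down) (ξ i.down) * h i := by
  simp [coordOp]

variable {L} in
theorem star_coordOp_apply (ξ : Sections L) (h : lp (fun _ : ULift.{v, u} X => ℂ) 2)
    (i : ULift.{v, u} X) :
    star (coordOp ξ) h i = inner ℂ (ξ i.down) (unitVector L i.down) * h i := by
  rw [coordOp, ← diagOp_star, diagOp_apply, lp.star_apply, boundedFun_apply, RCLike.star_def,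
    inner_conj_symm]

variable {L} in
theorem inner_mul_inner_unitVector (x : X) (u w : L x) :
    inner ℂ u (unitVector L x) * inner ℂ (unitVector L x) w = inner ℂ u w := by
  have h := inner_smul_eq_inner_smul x (unitVector L x) (unitVector L x) w
  rw [inner_self_eq_norm_sq_to_K, norm_unitVector] at h
  have h2 := congrArg (fun v => inner ℂ u v) h
  simp only [_root_.inner_smul_right] at h2
  rw [mul_comm, h2]
  simp

variable {L} in
theorem star_coordOp_mul_coordOp (ξ η : Sections L) :
    star (coordOp ξ) * coordOp η = mulRep (ULift.down : ULift.{v, u} X → X)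
      (inner C(X, ℂ) ξ η) := by
  ext h i
  change star (coordOp ξ) (coordOp η h) i = _
  rw [star_coordOp_apply, coordOp_apply, mulRep_apply, ← mul_assoc, inner_mul_inner_unitVector,
    Sections.inner_apply]

variable {L} in
theorem coordOp_mul_star_coordOp (ξ η : Sections L) :
    coordOp ξ * star (coordOp η) = mulRep (ULift.down : ULift.{v, u} X → X)
      (inner C(X, ℂ) η ξ) := by
  ext h i
  change coordOp ξ (star (coordOp η) h) i = _
  rw [coordOp_apply, star_coordOp_apply, mulRep_apply, ← mul_assoc, mul_comm (inner ℂ _ _),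
    inner_mul_inner_unitVector, Sections.inner_apply]

/-- The operators `t(ξ)` on `ℓ²(X)`: multiplication by the coordinates of `ξ`, followed by `α`. -/
def ellTwoT : Sections L →ₗ[ℂ]
    (lp (fun _ : ULift.{v, u} X => ℂ) 2 →L[ℂ] lp (fun _ : ULift.{v, u} X => ℂ) 2) where
  toFun ξ := permOp (liftPerm α) * coordOp ξ
  map_add' ξ η := by
    ext h i
    simp [add_mul]
  map_smul' c ξ := by
    ext h i
    simp [mul_assoc]

theorem ellTwoT_apply (ξ : Sections L) :
    ellTwoT L α ξ = permOp (liftPerm α) * coordOp ξ := rfl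

theorem star_ellTwoT_mul_ellTwoT (ξ η : Sections L) :
    star (ellTwoT L α ξ) * ellTwoT L α η =
      mulRep (ULift.down : ULift.{v, u} X → X) (inner C(X, ℂ) ξ η) := by
  rw [ellTwoT_apply, ellTwoT_apply, star_mul, mul_assoc, ← mul_assoc (star (permOp _)),
    star_permOp_mul_permOp, one_mul, star_coordOp_mul_coordOp]

theorem mulRep_mul_permOp (f : C(X, ℂ)) :
    mulRep (ULift.down : ULift.{v, u} X → X) f * permOp (liftPerm α) =
      permOp (liftPerm α) * mulRep ULift.down (f.comp (α : C(X, X))) :=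
  diagOp_mul_permOp _ fun _ => rfl

theorem mulRep_mul_ellTwoT (f : C(X, ℂ)) (ξ : Sections L) :
    mulRep (ULift.down : ULift.{v, u} X → X) f * ellTwoT L α ξ =
      ellTwoT L α ((sectionCorrespondence L α).φ f ξ) := by
  rw [ellTwoT_apply, ellTwoT_apply, ← mul_assoc, mulRep_mul_permOp, mul_assoc]
  congr 1
  ext h i
  change mulRep (ULift.down : ULift.{v, u} X → X) (f.comp (α : C(X, X))) (coordOp ξ h) i = _
  rw [mulRep_apply, coordOp_apply, coordOp_apply, sectionCorrespondence_apply,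
    _root_.inner_smul_right, mul_assoc]
  rfl

theorem ellTwoT_mul_star_ellTwoT (ξ η : Sections L) :
    ellTwoT L α ξ * star (ellTwoT L α η) = mulRep (ULift.down : ULift.{v, u} X → X)
      ((inner C(X, ℂ) η ξ : C(X, ℂ)).comp (α.symm : C(X, X))) := by
  have h := mulRep_mul_permOp.{u, v} α
    ((inner C(X, ℂ) η ξ : C(X, ℂ)).comp (α.symm : C(X, X)))
  have hf : ((inner C(X, ℂ) η ξ : C(X, ℂ)).comp (α.symm : C(X, X))).comp (α : C(X, X)) =
      inner C(X, ℂ) η ξ := by ext x; simp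
  rw [hf] at h
  rw [ellTwoT_apply, ellTwoT_apply, star_mul, mul_assoc, ← mul_assoc (coordOp ξ),
    coordOp_mul_star_coordOp, ← mul_assoc, ← h, mul_assoc, permOp_mul_star_permOp, mul_one]

theorem norm_ellTwoT_le (ξ : Sections L) : ‖ellTwoT L α ξ‖ ≤ ‖ξ‖ := by
  have h : ‖ellTwoT L α ξ‖ ^ 2 ≤ ‖ξ‖ ^ 2 := by
    rw [CStarModule.norm_sq_eq C(X, ℂ) (x := ξ), pow_two, ← CStarRing.norm_star_mul_self,
      star_ellTwoT_mul_ellTwoT]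
    exact NonUnitalStarAlgHom.norm_apply_le _ _
  exact (pow_le_pow_iff_left₀ (norm_nonneg _) (norm_nonneg _) two_ne_zero).1 h

/-- For a frame `ξᵢ`, the map `ψ_t` on compact operators is `K ↦ ∑ t(K ξᵢ) t(ξᵢ)^*`. -/
theorem exists_compactOps_map : ∃ ψ : compactOps C(X, ℂ) (Sections L) →L[ℂ]
    (lp (fun _ : ULift.{v, u} X => ℂ) 2 →L[ℂ] lp (fun _ : ULift.{v, u} X => ℂ) 2),
    (∀ ξ η : Sections L, ψ ⟨rankOneOp C(X, ℂ) ξ η, rankOneOp_mem ξ η⟩ =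
      ellTwoT L α ξ * star (ellTwoT L α η)) ∧
    ∀ (f : C(X, ℂ)) (hf : f ∈ (sectionCorrespondence L α).katsuraIdeal),
      mulRep (ULift.down : ULift.{v, u} X → X) f =
        ψ ⟨(sectionCorrespondence L α).φ f, (sectionCorrespondence L α).φ_mem hf⟩ := by
  obtain ⟨n, ξ, hξ⟩ := Sections.exists_frame L
  let T : Sections L →L[ℂ]
      (lp (fun _ : ULift.{v, u} X => ℂ) 2 →L[ℂ] lp (fun _ : ULift.{v, u} X => ℂ) 2) :=
    LinearMap.mkContinuous (ellTwoT L α) 1 fun ξ => by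
      rw [one_mul]
      exact norm_ellTwoT_le L α ξ
  let ψ : compactOps C(X, ℂ) (Sections L) →L[ℂ]
      (lp (fun _ : ULift.{v, u} X => ℂ) 2 →L[ℂ] lp (fun _ : ULift.{v, u} X => ℂ) 2) :=
    ∑ i, (((ContinuousLinearMap.mul ℂ _).flip (star (ellTwoT L α (ξ i)))).comp
      (T.comp ((ContinuousLinearMap.apply ℂ (Sections L) (ξ i)).comp
        (compactOps C(X, ℂ) (Sections L)).subtypeL)))
  have hψ (K : compactOps C(X, ℂ) (Sections L)) :
      ψ K = ∑ i, ellTwoT L α (K.1 (ξ i)) * star (ellTwoT L α (ξ i)) := by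
    simp only [ψ, sum_apply]
    rfl
  refine ⟨ψ, fun ζ η => ?_, fun f hf => ?_⟩
  · rw [hψ]
    simp only [rankOneOp_apply, ellTwoT_mul_star_ellTwoT]
    rw [← map_sum]
    congr 1
    ext x
    rw [ContinuousMap.sum_apply]
    have h (i : Fin n) : ((inner C(X, ℂ) (ξ i) ((inner C(X, ℂ) η (ξ i) : C(X, ℂ)) • ζ) : C(X, ℂ)).comp
        (α.symm : C(X, X))) x = (inner C(X, ℂ) (ξ i) (ξ i) : C(X, ℂ)) (α.symm x) *
          (inner C(X, ℂ) η ζ : C(X, ℂ)) (α.symm x) := by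
      change (inner C(X, ℂ) (ξ i) ((inner C(X, ℂ) η (ξ i) : C(X, ℂ)) • ζ) : C(X, ℂ)) (α.symm x) = _
      simp only [Sections.inner_apply, Sections.fun_smul_apply]
      rw [inner_smul_eq_inner_smul, _root_.inner_smul_right, mul_comm]
    simp only [h]
    rw [← Finset.sum_mul, ← ContinuousMap.sum_apply, hξ]
    simp
  · rw [hψ]
    simp only [← mulRep_mul_ellTwoT, mul_assoc, ellTwoT_mul_star_ellTwoT]
    rw [← Finset.mul_sum, ← map_sum, ← map_mul]
    congr 1
    ext x
    have h := DFunLike.congr_fun hξ (α.symm x)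
    rw [ContinuousMap.sum_apply] at h
    rw [ContinuousMap.mul_apply, ContinuousMap.sum_apply]
    simp only [ContinuousMap.comp_apply, ContinuousMap.coe_coe, h, ContinuousMap.one_apply, mul_one]

/-- The covariant representation of `Γ(L, α)` on `ℓ²(X)`. -/
def ellTwoRep : (sectionCorrespondence L α).CovariantRep where
  B := lp (fun _ : ULift.{v, u} X => ℂ) 2 →L[ℂ] lp (fun _ : ULift.{v, u} X => ℂ) 2
  π := (mulRep (ULift.down : ULift.{v, u} X → X) : C(X, ℂ) →⋆ₙₐ[ℂ] _)
  t := ellTwoT L α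
  map_inner ξ η := (star_ellTwoT_mul_ellTwoT L α ξ η).symm
  map_left f ξ := mulRep_mul_ellTwoT L α f ξ
  covariant := exists_compactOps_map L α

theorem norm_univπ (f : C(X, ℂ)) : ‖(sectionCorrespondence L α).univπ f‖ = ‖f‖ := by
  refine le_antisymm (NonUnitalStarAlgHom.norm_apply_le _ f) ?_
  refine (norm_le_norm_mulRep (p := (ULift.down : ULift.{v, u} X → X)) ULift.down_surjective f).trans ?_
  exact lp.norm_apply_le_norm ENNReal.top_ne_zero
    ((sectionCorrespondence L α).ambientπ f) (ellTwoRep L α)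

/-- The Cuntz–Pimsner algebra of `Γ(L, α)` as a gauge system. -/
def cuntzPimsnerSystem :
    GaugeSystem α (sectionCorrespondence L α).cuntzPimsner where
  π := (sectionCorrespondence L α).univπ
  norm_π := norm_univπ L α
  ι := Sections L
  t := (sectionCorrespondence L α).univT
  ip ξ η := inner C(X, ℂ) ξ η
  star_t_mul_t ξ η := by
    refine Subtype.ext (lp.ext (funext fun R => ?_))
    exact (R.map_inner ξ η).symm
  t_mul_star_t ξ η := by
    refine Subtype.ext (lp.ext (funext fun R => ?_))
    exact covariantRep_t_mul_star_t α R ξ η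
  π_mul_t f ξ := by
    refine Subtype.ext (lp.ext (funext fun R => ?_))
    exact (R.map_left f ξ).trans (covariantRep_t_smul R (f.comp (α : C(X, X))) ξ)
  n := (Sections.exists_frame L).choose
  frame := (Sections.exists_frame L).choose_spec.choose
  sum_ip_frame := (Sections.exists_frame L).choose_spec.choose_spec
  generates S hS hπ ht := NonUnitalStarAlgebra.mem_of_subset_of_isClosed _ S hS (by
    rintro _ (⟨f, rfl⟩ | ⟨ξ, rfl⟩)
    · exact ⟨_, hπ f, rfl⟩
    · exact ⟨_, ht ξ, rfl⟩)
  σ := (sectionCorrespondence L α).gauge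
  σ_π _ _ := rfl
  σ_t _ _ := rfl

end CuntzPimsner

end

theorem mainTheorem11 {X : Type u} [MetricSpace X] [CompactSpace X] [Infinite X]
    [MeasurableSpace X] [BorelSpace X]
    (L : X → Type v) [∀ x, NormedAddCommGroup (L x)] [∀ x, InnerProductSpace ℂ (L x)]
    [TopologicalSpace (Bundle.TotalSpace ℂ L)] [FiberBundle ℂ L] [VectorBundle ℂ ℂ L]
    [IsHermitianLineBundle L]
    (α : X ≃ₜ X) (hα : ∀ (n : ℤ) (x : X), n ≠ 0 → (α ^ n) x ≠ x) :
    (∃ (Θ : tracialStates (sectionCorrespondence L α).cuntzPimsner ≃ₜ invariantMeasures α)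
        (Ψ : tracialStates (crossedProduct (α.symm.compStarAlgEquiv' ℂ ℂ)) ≃ₜ
          invariantMeasures α),
      IsAffineVia Θ (fun τ => τ.1) (fun μ => (μ.1 : Measure X)) ∧
      IsAffineVia Ψ (fun τ => τ.1) (fun μ => (μ.1 : Measure X)) ∧
      IsAffineVia (Θ.trans Ψ.symm) (fun τ => τ.1) (fun τ => τ.1) ∧
      (∀ (τ : tracialStates (sectionCorrespondence L α).cuntzPimsner) (f : C(X, ℂ)),
        (τ : WeakDual ℂ _) ((sectionCorrespondence L α).univπ f) =
          ∫ x, f x ∂((Θ τ : ProbabilityMeasure X) : Measure X)) ∧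
      (∀ (τ : tracialStates (crossedProduct (α.symm.compStarAlgEquiv' ℂ ℂ))) (f : C(X, ℂ)),
        (τ : WeakDual ℂ _) (crossedπ (α.symm.compStarAlgEquiv' ℂ ℂ) f) =
          ∫ x, f x ∂((Ψ τ : ProbabilityMeasure X) : Measure X))) ∧
    (∀ a : (sectionCorrespondence L α).cuntzPimsner,
      (sectionCorrespondence L α).gaugeExpectation a ∈
        Set.range (sectionCorrespondence L α).univπ) ∧
    (∀ τ ∈ tracialStates (sectionCorrespondence L α).cuntzPimsner,
      ∀ a : (sectionCorrespondence L α).cuntzPimsner,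
        τ a = τ ((sectionCorrespondence L α).gaugeExpectation a)) := by
  have hinj : Function.Injective fun μ : invariantMeasures α => (μ.1 : Measure X) :=
    fun μ ν h => Subtype.ext (Subtype.ext h)
  have hcomp := IsAffineVia.comp hinj ((crossedSystem α).isAffineVia_tracialEquiv hα)
    ((cuntzPimsnerSystem L α).isAffineVia_tracialHomeomorph hα)
  refine ⟨⟨(cuntzPimsnerSystem L α).tracialHomeomorph hα, (crossedSystem α).tracialHomeomorph hα,
    (cuntzPimsnerSystem L α).isAffineVia_tracialHomeomorph hα,
    (crossedSystem α).isAffineVia_tracialHomeomorph hα,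
    hcomp,
    (cuntzPimsnerSystem L α).apply_π_eq_integral hα, (crossedSystem α).apply_π_eq_integral hα⟩,
    (cuntzPimsnerSystem L α).expect_mem_range, fun τ hτ =>
      (cuntzPimsnerSystem L α).trace_eq_trace_expect hα hτ.2.2⟩
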